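/- \textbf{Linear PEGs.} Let $\Sigma$ and $N$ be finite sets of terminals and nonterminals. Parsing expressions are built from $\epsilon$, $a\in\Sigma$, the any-character expression $\bullet$, $A\in N$, sequence $e_1e_2$, prioritized choice $e_1/e_2$, greedy repetition $e^*$ and not-predicate $!e$. On an input $x\in\Sigma^*$ an expression may succeed, consuming a prefix $y$ of $x$ ($consume(e,x)=y$), or fail ($consume(e,x)=fail$), with the usual PEG semantics; a non-terminating evaluation has neither outcome. \emph{Linear} expressions are given by $e ::= p \mid A\mid p\,A \mid p\,e \mid e/e \mid {!e}\,e$, where $p$ ranges over the expressions without nonterminals. An LPEG $G=(N,\Sigma,P_G,e_S)$ has one rule $A\leftarrow P_G(A)$ for each $A\in N$, and all $P_G(A)$ and the start expression $e_S$ are linear. $L(G)$ is the set of $x\in\Sigma^*$ on which $e_S$ succeeds. We assume that $G$ is \emph{total}: on every $x\in\Sigma^*$, $e_S$ either succeeds or fails. \textbf{Step 1.} Replace $\bullet$ by the choice $a/b/\dots/c$ of all terminals (by an always failing expression if $\Sigma=\emptyset$), and every $e_1/e_2$ by $e_1\mid {!e_1}\,e_2$, where $e_1\mid e_2$ succeeds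 with each outcome with which $e_1$ or $e_2$ succeeds, and fails if both fail. \textbf{Step 2.} For each $A\in N$ add a new nonterminal $A'$. Let $copy(e)$ be $e$ with every $A$ renamed $A'$, and let $C_n(e)$ be $e$ with the nonterminals inside not-predicates (and only these) renamed in this way. $C_G(G)$ has the rules $A\leftarrow C_n(e)$ and $A'\leftarrow copy(e)$ for each rule $A\leftarrow e$ obtained in Step 1, and the start expression $C_n(e_S)$. \textbf{BFAs.} A boolean finite automaton is $B=(Q,\Sigma,\delta,f^0,F,P)$ with $Q$ finite, $F,P\subseteq Q$, $f^0$ a boolean function of the variables $q\in Q$, and $\delta$ assigning such a function to each $(q,a)\in Q\times\Sigma$ ($false$ where not specified). One puts $\delta(f,\epsilon)=f$ and $\delta(f,aw)=\delta(f[q:=\delta(q,a)]_{q\in Q},w)$. Then $x\in L(B)$ iff $\delta(f^0,x)$ is true when exactly the $q\in F\cup P$ are set to $true$. \textbf{Step 3.} Let $\phi(f_1,f_2,F)$ be $f_1$ with each variable $s\in F$ replaced by $s\lor f_2$. Define $T$ recursively from left to right on expressions of $C_G(G)$, with fresh states in each clause: \begin{itemize} \item $T(\epsilon)=(\{s\},\Sigma,\{\},s,\{s\},\{\})$,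 and $T(a)=(\{s,t\},\Sigma,\{((s,a),t)\},s,\{t\},\{\})$; \item $T(!e)=(Q\cup\{s\},\Sigma,\delta\cup\{((t,a),t): t\in F\cup P,\,a\in\Sigma\},s\land\overline{f^0},\{s\},F\cup P)$, where $T(e)=(Q,\Sigma,\delta,f^0,F,P)$; \item $T(e_1e_2)=(Q_1\cup Q_2,\Sigma,\{((s,a),\phi(g,f^0_2,F_1)):((s,a),g)\in\delta_1\}\cup\delta_2,\phi(f^0_1,f^0_2,F_1),F_2,P_1\cup P_2)$, and $T(e_1\mid e_2)=(Q_1\cup Q_2,\Sigma,\delta_1\cup\delta_2,f_1^0\lor f_2^0,F_1\cup F_2,P_1\cup P_2)$, where $T(e_i)=(Q_i,\Sigma,\delta_i,f^0_i,F_i,P_i)$; \item for a nonterminal $A$ of $C_G(G)$, $T(A)$ is $T$ of the right-hand side of its rule at the first application, and $(\{\},\Sigma,\{\},f_{tmp_A},\{\},\{\})$, with a temporary variable $f_{tmp_A}$, at later ones; \item for a repetition, $T(p^*)$ is the BFA obtained for a fresh nonterminal $R$ with the rules $R\leftarrow p\,R\mid{!(p\,R')}\,\epsilon$ and $R'\leftarrow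 p\,R'\mid{!(p\,R')}\,\epsilon$, i.e. Steps 1 and 2 applied to $R\leftarrow p\,R/\epsilon$; the temporary variables of $R$ and $R'$ are replaced by their initial functions at once. \end{itemize} \textbf{Step 4.} Let $B$ be $T(C_n(e_S)\,\bullet^*)$ in which every temporary variable $f_{tmp_A}$ is replaced, repeatedly until none is left, by the initial function of $A$, that is, the initial function of the first application of $A$ after all modifications by $\phi$ made by enclosing sequences. (A temporary variable that survives as many rounds of replacement as there are temporary variables, because of a cyclic dependency, is set to $false$.) \textbf{Theorem.} Let $G$ be a total LPEG and let $B$ be constructed by Steps 1--4. Then $B$ is a boolean finite automaton (its initial function, its transitions and its accepting states involve only its finitely many states), and $$L(G)=L(C_G(G))=L(B).$$ -/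

import Mathlib

/-! ### Parsing expressions, linear parsing expressions, and the function `consume` -/

/-- Parsing expressions over the terminals `σ` and the nonterminals `N`. -/
inductive PExp (σ N : Type*) where
  | empty : PExp σ N
  | char (a : σ) : PExp σ N
  | any : PExp σ N
  | nt (A : N) : PExp σ N
  | seq (e₁ e₂ : PExp σ N) : PExp σ N
  | choice (e₁ e₂ : PExp σ N) : PExp σ N
  | star (e : PExp σ N) : PExp σ N
  | not (e : PExp σ N) : PExp σ N

namespace PExp

variable {σ N : Type*}

/-- An expression is nonterminal-free if it contains no nonterminal. -/
def NFree : PExp σ N → Prop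
  | empty => True
  | char _ => True
  | any => True
  | nt _ => False
  | seq e₁ e₂ => e₁.NFree ∧ e₂.NFree
  | choice e₁ e₂ => e₁.NFree ∧ e₂.NFree
  | star e => e.NFree
  | not e => e.NFree

/-- Linear parsing expressions, `e ::= p | p A | p e | e / e | !e e` with `p` nonterminal-free.
A lone nonterminal `A` (short for `ε A`) is admitted too, so that `p A` is an instance of `p e`. -/
inductive IsLinear : PExp σ N → Prop
  | nfree {p : PExp σ N} : p.NFree → IsLinear p
  | nt (A : N) : IsLinear (nt A)
  | seq {p e : PExp σ N} : p.NFree → IsLinear e → IsLinear (seq p e)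
  | choice {e₁ e₂ : PExp σ N} : IsLinear e₁ → IsLinear e₂ → IsLinear (choice e₁ e₂)
  | notSeq {e₁ e₂ : PExp σ N} : IsLinear e₁ → IsLinear e₂ → IsLinear (seq (not e₁) e₂)

/-- `Consume rule e x (some y)`: on the input `x` the expression `e` succeeds and consumes the
prefix `y`. `Consume rule e x none`: on the input `x` the expression `e` fails. An evaluation that
does not terminate has neither outcome. -/
inductive Consume (rule : N → PExp σ N) : PExp σ N → List σ → Option (List σ) → Prop
  | empty (x : List σ) : Consume rule empty x (some [])
  | char (a : σ) (x : List σ) : Consume rule (char a) (a :: x) (some [a])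
  | char_ne {a b : σ} (x : List σ) : a ≠ b → Consume rule (char a) (b :: x) none
  | char_nil (a : σ) : Consume rule (char a) [] none
  | any (a : σ) (x : List σ) : Consume rule any (a :: x) (some [a])
  | any_nil : Consume rule any [] none
  | nt {A : N} {x : List σ} {r : Option (List σ)} :
      Consume rule (rule A) x r → Consume rule (nt A) x r
  | seq {e₁ e₂ : PExp σ N} {x y w z : List σ} : x = y ++ w →
      Consume rule e₁ x (some y) → Consume rule e₂ w (some z) →
      Consume rule (seq e₁ e₂) x (some (y ++ z))
  | seq_fail_left {e₁ e₂ : PExp σ N} {x : List σ} :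
      Consume rule e₁ x none → Consume rule (seq e₁ e₂) x none
  | seq_fail_right {e₁ e₂ : PExp σ N} {x y w : List σ} : x = y ++ w →
      Consume rule e₁ x (some y) → Consume rule e₂ w none →
      Consume rule (seq e₁ e₂) x none
  | choice_left {e₁ e₂ : PExp σ N} {x y : List σ} :
      Consume rule e₁ x (some y) → Consume rule (choice e₁ e₂) x (some y)
  | choice_right {e₁ e₂ : PExp σ N} {x : List σ} {r : Option (List σ)} :
      Consume rule e₁ x none → Consume rule e₂ x r → Consume rule (choice e₁ e₂) x r
  | star_stop {e : PExp σ N} {x : List σ} :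
      Consume rule e x none → Consume rule (star e) x (some [])
  | star_step {e : PExp σ N} {x y w z : List σ} : x = y ++ w →
      Consume rule e x (some y) → Consume rule (star e) w (some z) →
      Consume rule (star e) x (some (y ++ z))
  | not {e : PExp σ N} {x : List σ} :
      Consume rule e x none → Consume rule (not e) x (some [])
  | not_fail {e : PExp σ N} {x y : List σ} :
      Consume rule e x (some y) → Consume rule (not e) x none

end PExp

/-- A parsing expression grammar with nonterminals `N` and terminals `σ`: one production rule for
each nonterminal, and a start expression. -/
structure PEG (σ N : Type*) where
  rule : N → PExp σ N
  start : PExp σ N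

namespace PEG

variable {σ N : Type*}

/-- A linear PEG: all expressions of the grammar are linear. -/
def IsLPEG (G : PEG σ N) : Prop :=
  G.start.IsLinear ∧ ∀ A, (G.rule A).IsLinear

/-- The start expression either succeeds or fails on every input. -/
def IsTotal (G : PEG σ N) : Prop :=
  ∀ x : List σ, ∃ r, PExp.Consume G.rule G.start x r

/-- `L(G)`: the inputs on which the start expression succeeds. -/
def language (G : PEG σ N) : Language σ :=
  {x | ∃ y, PExp.Consume G.rule G.start x (some y)}

end PEG

/-! ### Step 1: prioritized choice is rewritten as alternation -/

/-- Parsing expressions with unordered alternation `e₁ | e₂` in place of prioritized choice. -/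
inductive AExp (σ N : Type*) where
  | empty : AExp σ N
  | char (a : σ) : AExp σ N
  | nt (A : N) : AExp σ N
  | seq (e₁ e₂ : AExp σ N) : AExp σ N
  | alt (e₁ e₂ : AExp σ N) : AExp σ N
  | star (e : AExp σ N) : AExp σ N
  | not (e : AExp σ N) : AExp σ N

namespace AExp

variable {σ N : Type*}

/-- The function `consume` for expressions with alternation, as a relation. -/
inductive Consume (rule : N → AExp σ N) : AExp σ N → List σ → Option (List σ) → Prop
  | empty (x : List σ) : Consume rule empty x (some [])
  | char (a : σ) (x : List σ) : Consume rule (char a) (a :: x) (some [a])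
  | char_ne {a b : σ} (x : List σ) : a ≠ b → Consume rule (char a) (b :: x) none
  | char_nil (a : σ) : Consume rule (char a) [] none
  | nt {A : N} {x : List σ} {r : Option (List σ)} :
      Consume rule (rule A) x r → Consume rule (nt A) x r
  | seq {e₁ e₂ : AExp σ N} {x y w z : List σ} : x = y ++ w →
      Consume rule e₁ x (some y) → Consume rule e₂ w (some z) →
      Consume rule (seq e₁ e₂) x (some (y ++ z))
  | seq_fail_left {e₁ e₂ : AExp σ N} {x : List σ} :
      Consume rule e₁ x none → Consume rule (seq e₁ e₂) x none
  | seq_fail_right {e₁ e₂ : AExp σ N} {x y w : List σ} : x = y ++ w →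
      Consume rule e₁ x (some y) → Consume rule e₂ w none →
      Consume rule (seq e₁ e₂) x none
  | alt_left {e₁ e₂ : AExp σ N} {x y : List σ} :
      Consume rule e₁ x (some y) → Consume rule (alt e₁ e₂) x (some y)
  | alt_right {e₁ e₂ : AExp σ N} {x y : List σ} :
      Consume rule e₂ x (some y) → Consume rule (alt e₁ e₂) x (some y)
  | alt_fail {e₁ e₂ : AExp σ N} {x : List σ} :
      Consume rule e₁ x none → Consume rule e₂ x none → Consume rule (alt e₁ e₂) x none
  | star_stop {e : AExp σ N} {x : List σ} :
      Consume rule e x none → Consume rule (star e) x (some [])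
  | star_step {e : AExp σ N} {x y w z : List σ} : x = y ++ w →
      Consume rule e x (some y) → Consume rule (star e) w (some z) →
      Consume rule (star e) x (some (y ++ z))
  | not {e : AExp σ N} {x : List σ} :
      Consume rule e x none → Consume rule (not e) x (some [])
  | not_fail {e : AExp σ N} {x y : List σ} :
      Consume rule e x (some y) → Consume rule (not e) x none

/-- Renaming of nonterminals. -/
def rename {N' : Type*} (g : N → N') : AExp σ N → AExp σ N'
  | empty => empty
  | char a => char a
  | nt A => nt (g A)
  | seq e₁ e₂ => seq (e₁.rename g) (e₂.rename g)
  | alt e₁ e₂ => alt (e₁.rename g) (e₂.rename g)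
  | star e => star (e.rename g)
  | not e => not (e.rename g)

/-- The any-character expression `a / b / … / c` over a list of terminals, after rewriting of the
choices: `a | !a (b | !b (… | …))`. For an empty list it is an expression that always fails. -/
def anyOf : List σ → AExp σ N
  | [] => not empty
  | [a] => char a
  | a :: b :: l => alt (char a) (seq (not (char a)) (anyOf (b :: l)))

end AExp

/-- The rewriting of `e₁ / e₂` as `e₁ | !e₁ e₂`, throughout an expression. The list `l` enumerates
the terminals; the any-character expression is the choice between all of them. -/
def PExp.unorder {σ N : Type*} (l : List σ) : PExp σ N → AExp σ N
  | .empty => .empty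
  | .char a => .char a
  | .any => AExp.anyOf l
  | .nt A => .nt A
  | .seq e₁ e₂ => .seq (e₁.unorder l) (e₂.unorder l)
  | .choice e₁ e₂ => .alt (e₁.unorder l) (.seq (.not (e₁.unorder l)) (e₂.unorder l))
  | .star e => .star (e.unorder l)
  | .not e => .not (e.unorder l)

/-- Grammars over expressions with alternation. -/
structure AGrammar (σ N : Type*) where
  rule : N → AExp σ N
  start : AExp σ N

/-- The language of a grammar over expressions with alternation. -/
def AGrammar.language {σ N : Type*} (G : AGrammar σ N) : Language σ :=
  {x | ∃ y, AExp.Consume G.rule G.start x (some y)}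

/-- The first step, applied to a grammar. -/
def PEG.unorder {σ N : Type*} (l : List σ) (G : PEG σ N) : AGrammar σ N where
  rule A := (G.rule A).unorder l
  start := G.start.unorder l

/-! ### Step 2: nonterminals inside not-predicates are duplicated

The nonterminals of the new grammar are `N ⊕ N`: `Sum.inl A` is `A` and `Sum.inr A` is its copy
`A'`. -/

/-- `copy`: every nonterminal `A` is renamed as `A'`. -/
def AExp.copy {σ N : Type*} (e : AExp σ N) : AExp σ (N ⊕ N) :=
  e.rename Sum.inr

/-- `C_n`: nonterminals inside not-predicates are renamed as their copies. In particular an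
expression without nonterminals stays the same. -/
def AExp.modify {σ N : Type*} : AExp σ N → AExp σ (N ⊕ N)
  | .empty => .empty
  | .char a => .char a
  | .nt A => .nt (Sum.inl A)
  | .seq e₁ e₂ => .seq e₁.modify e₂.modify
  | .alt e₁ e₂ => .alt e₁.modify e₂.modify
  | .star e => .star e.modify
  | .not e => .not e.copy

/-- `C_G`: the rules are `A ← C_n(e)` and `A' ← copy(e)` for every rule `A ← e`, and the start
expression is modified by `C_n`. -/
def AGrammar.modify {σ N : Type*} (G : AGrammar σ N) : AGrammar σ (N ⊕ N) where
  rule := Sum.elim (fun A => (G.rule A).modify) (fun A => (G.rule A).copy)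
  start := G.start.modify

/-! ### Boolean finite automata -/

/-- Boolean functions of the variables `V`, written with constants, variables, and the logical
connectives. -/
inductive BForm (V : Type*) where
  | const (b : Bool) : BForm V
  | var (v : V) : BForm V
  | conj (f g : BForm V) : BForm V
  | disj (f g : BForm V) : BForm V
  | neg (f : BForm V) : BForm V

namespace BForm

variable {V : Type*}

/-- The value of a boolean function at an assignment. -/
def eval (c : V → Bool) : BForm V → Bool
  | const b => b
  | var v => c v
  | conj f g => f.eval c && g.eval c
  | disj f g => f.eval c || g.eval c
  | neg f => !f.eval c

/-- Simultaneous substitution of boolean functions for the variables. -/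
def subst (s : V → BForm V) : BForm V → BForm V
  | const b => const b
  | var v => s v
  | conj f g => conj (f.subst s) (g.subst s)
  | disj f g => disj (f.subst s) (g.subst s)
  | neg f => neg (f.subst s)

/-- The set of variables that occur. -/
def vars : BForm V → Set V
  | const _ => ∅
  | var v => {v}
  | conj f g => f.vars ∪ g.vars
  | disj f g => f.vars ∪ g.vars
  | neg f => f.vars

/-- `φ(f₁, f₂, F)`: each variable `s ∈ F` of `f₁` is replaced by `s ∨ f₂`. -/
def phi [DecidableEq V] (f₁ f₂ : BForm V) (F : Finset V) : BForm V :=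
  f₁.subst fun s => if s ∈ F then disj (var s) f₂ else var s

/-- Replacement of temporary variables: `tbl v = some g` says that `v` is a temporary variable that
stands for `g`. As `g` may contain temporary variables itself, the replacement is iterated; those
that survive `k` further rounds (which takes a cycle among the temporary variables if there are at
most `k` of them) become `false`. -/
def unroll (tbl : V → Option (BForm V)) : ℕ → V → BForm V
  | 0, v => match tbl v with
    | none => var v
    | some _ => const false
  | k + 1, v => match tbl v with
    | none => var v
    | some g => g.subst (unroll tbl k)

end BForm

/-- A boolean finite automaton, with its accepting states in two sets `F` and `P`. Transitions that
are not specified are `false`. -/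
structure BFA (σ V : Type*) where
  Q : Finset V
  δ : V → σ → BForm V
  f₀ : BForm V
  F : Finset V
  P : Finset V

namespace BFA

variable {σ V : Type*}

/-- `B` is an automaton on the finite state set `Q`: the initial function and the transitions are
boolean functions of the variables in `Q`, and the accepting states are in `Q`. -/
def WellFormed (B : BFA σ V) : Prop :=
  B.f₀.vars ⊆ ↑B.Q ∧ (∀ q ∈ B.Q, ∀ a, (B.δ q a).vars ⊆ ↑B.Q) ∧ B.F ⊆ B.Q ∧ B.P ⊆ B.Q

/-- The transition function on boolean functions and strings: `δ(f, ε) = f`,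
`δ(f, a w) = δ(f(δ(q₁, a), …, δ(qₙ, a)), w)`. -/
def run (B : BFA σ V) : BForm V → List σ → BForm V
  | f, [] => f
  | f, a :: w => B.run (f.subst fun q => B.δ q a) w

/-- The language accepted by a BFA. -/
def language [DecidableEq V] (B : BFA σ V) : Language σ :=
  {x | (B.run B.f₀ x).eval (fun q => decide (q ∈ B.F ∪ B.P)) = true}

end BFA

/-! ### Steps 3 and 4: from modified grammars to BFAs -/

/-- Boolean variables: states, which are numbered, and the temporary variables of nonterminals. -/
inductive BVar (M : Type*) where
  | state (n : ℕ) : BVar M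
  | tmp (A : M) : BVar M
  deriving DecidableEq

/-- A BFA under construction. `inits` lists the nonterminals that have been expanded in it, with
their initial functions. -/
structure PreBFA (σ M : Type*) extends BFA σ (BVar M) where
  inits : List (M × BForm (BVar M))

namespace PreBFA

variable {σ M : Type*} [DecidableEq M]

/-- The automaton without states whose initial function is the variable `v`. -/
def ofVar (v : BVar M) : PreBFA σ M where
  Q := ∅
  δ := fun _ _ => .const false
  f₀ := .var v
  F := ∅
  P := ∅
  inits := []

/-- `T(ε)`, with the state `s`. -/
def eps (s : ℕ) : PreBFA σ M where
  Q := {.state s}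
  δ := fun _ _ => .const false
  f₀ := .var (.state s)
  F := {.state s}
  P := ∅
  inits := []

/-- `T(a)`, with the states `s` and `t`. -/
def char [DecidableEq σ] (a : σ) (s t : ℕ) : PreBFA σ M where
  Q := {.state s, .state t}
  δ := fun q b => if q = .state s ∧ b = a then .var (.state t) else .const false
  f₀ := .var (.state s)
  F := {.state t}
  P := ∅
  inits := []

/-- `T(!e)` from `T(e)`, with the new state `s`. -/
def not (s : ℕ) (B : PreBFA σ M) : PreBFA σ M where
  Q := B.Q ∪ {.state s}
  δ := fun q a => .disj (B.δ q a) (if q ∈ B.F ∪ B.P then .var q else .const false)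
  f₀ := .conj (.var (.state s)) (.neg B.f₀)
  F := {.state s}
  P := B.F ∪ B.P
  inits := B.inits

/-- `T(e₁ e₂)` from `T(e₁)` and `T(e₂)`. The initial functions of the nonterminals expanded in
`e₁` are continued with `e₂`, like all the other boolean functions of `T(e₁)`. -/
def seq (B₁ B₂ : PreBFA σ M) : PreBFA σ M where
  Q := B₁.Q ∪ B₂.Q
  δ := fun q a => .disj ((B₁.δ q a).phi B₂.f₀ B₁.F) (B₂.δ q a)
  f₀ := B₁.f₀.phi B₂.f₀ B₁.F
  F := B₂.F
  P := B₁.P ∪ B₂.P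
  inits := B₁.inits.map (fun i => (i.1, i.2.phi B₂.f₀ B₁.F)) ++ B₂.inits

/-- `T(e₁ | e₂)` from `T(e₁)` and `T(e₂)`. -/
def alt (B₁ B₂ : PreBFA σ M) : PreBFA σ M where
  Q := B₁.Q ∪ B₂.Q
  δ := fun q a => .disj (B₁.δ q a) (B₂.δ q a)
  f₀ := .disj B₁.f₀ B₂.f₀
  F := B₁.F ∪ B₂.F
  P := B₁.P ∪ B₂.P
  inits := B₁.inits ++ B₂.inits

/-- Substitution in all boolean functions of an automaton. -/
def substAll (s : BVar M → BForm (BVar M)) (B : PreBFA σ M) : PreBFA σ M where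
  Q := B.Q
  δ := fun q a => (B.δ q a).subst s
  f₀ := B.f₀.subst s
  F := B.F
  P := B.P
  inits := B.inits.map fun i => (i.1, i.2.subst s)

/-- `T(p*)` from four disjoint copies `B₁, …, B₄` of `T(p)`. A repetition `p*` is a new nonterminal
`R` with the rule `R ← p R / ε`. By steps 1 and 2 this becomes the pair of rules
`R ← p R | !(p R') ε` and `R' ← p R' | !(p R') ε`. Below, `X` is `T` of the second right-hand side
and `Y` is `T(R)`, with the temporary variables `r` of `R` and `r'` of `R'`, which are then replaced
by the initial functions. The numbers `s₁, …, s₄` are the new states. -/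
def star (r r' s₁ s₂ s₃ s₄ : ℕ) (B₁ B₂ B₃ B₄ : PreBFA σ M) : PreBFA σ M :=
  let X := alt (seq B₃ (ofVar (.state r')))
    (seq (not s₃ (seq B₄ (ofVar (.state r')))) (eps s₄))
  let Y := alt (seq B₁ (ofVar (.state r)))
    (seq (not s₁ (seq B₂ X)) (eps s₂))
  Y.substAll <| BForm.unroll
    (fun v => if v = .state r then some Y.f₀ else if v = .state r' then some X.f₀ else none) 2

/-- The final step: the temporary variables of the nonterminals are replaced by the initial
functions of the nonterminals. -/
def replaceTmp [Fintype M] (B : PreBFA σ M) : BFA σ (BVar M) :=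
  (B.substAll <| BForm.unroll
    (fun v => match v with
      | .state _ => none
      | .tmp A => some ((B.inits.lookup A).getD (.const false)))
    (Fintype.card M)).toBFA

end PreBFA

/-- What the construction keeps track of: the next unused state number, and the nonterminals that
have already been applied. -/
structure TState (M : Type*) where
  next : ℕ
  applied : List M

namespace AExp

variable {σ M : Type*} [DecidableEq σ] [DecidableEq M]

/-- The function `T` on expressions, given what it does on nonterminals. -/
def conv (call : M → TState M → PreBFA σ M × TState M) :
    AExp σ M → TState M → PreBFA σ M × TState M
  | empty, S => (.eps S.next, { S with next := S.next + 1 })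
  | char a, S => (.char a S.next (S.next + 1), { S with next := S.next + 2 })
  | nt A, S => call A S
  | seq e₁ e₂, S =>
    let R₁ := conv call e₁ S
    let R₂ := conv call e₂ R₁.2
    (.seq R₁.1 R₂.1, R₂.2)
  | alt e₁ e₂, S =>
    let R₁ := conv call e₁ S
    let R₂ := conv call e₂ R₁.2
    (.alt R₁.1 R₂.1, R₂.2)
  | star e, S =>
    let n := S.next
    let R₁ := conv call e { S with next := n + 6 }
    let R₂ := conv call e R₁.2
    let R₃ := conv call e R₂.2
    let R₄ := conv call e R₃.2
    (.star n (n + 1) (n + 2) (n + 3) (n + 4) (n + 5) R₁.1 R₂.1 R₃.1 R₄.1, R₄.2)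
  | not e, S =>
    let R := conv call e { S with next := S.next + 1 }
    (.not S.next R.1, R.2)

/-- The function `T` on a nonterminal `A`: at the first application the rule of `A` is converted,
otherwise the result is the temporary variable of `A`. The number bounds the nesting of first
applications; a bound as large as the number of nonterminals is no restriction. -/
def convNT (rule : M → AExp σ M) : ℕ → M → TState M → PreBFA σ M × TState M
  | 0, A, S => (.ofVar (.tmp A), S)
  | k + 1, A, S =>
    if A ∈ S.applied then (.ofVar (.tmp A), S)
    else
      let R := conv (convNT rule k) (rule A) { S with applied := A :: S.applied }
      ({ R.1 with inits := (A, R.1.f₀) :: R.1.inits }, R.2)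

end AExp

/-- `T(e_S .*)` for the start expression `e_S` of a grammar, with its temporary variables replaced.
The list `l` enumerates the terminals. -/
def AGrammar.toBFA {σ M : Type*} [DecidableEq σ] [DecidableEq M] [Fintype M] (l : List σ)
    (G : AGrammar σ M) : BFA σ (BVar M) :=
  (AExp.conv (AExp.convNT G.rule (Fintype.card M)) (.seq G.start (.star (AExp.anyOf l)))
    ⟨0, []⟩).1.replaceTmp

/-!
The proof assigns to every boolean function of the final automaton its value on each remaining input
and shows that the initial function of the part built from an expression `e` has the value that the
outcome of `e` requires.

The outcomes are those of `AExp.Eval`, a deterministic form of `AExp.Consume`: in an alternation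
both sides are evaluated and at most one succeeds, rounds of a repetition consume something, and a
nonterminal is not applied inside its own evaluation before some input is consumed. By
`PExp.Consume.eval` every outcome in the given grammar is an outcome of this kind in the modified
grammar, and by `AExp.Eval.unique` there is no other. As the grammar is total, the start expression
has such an outcome on every input, so it suffices to compare the automaton with `AExp.Eval`.

For an expression without nonterminals, let the final states of its automaton have the value `c w`
on the remaining input `w`. `PreBFA.Correct` says that the initial function then has the value `c w`
if the expression succeeds and leaves `w`, and is false if it fails. In a sequence, `φ` puts the
value of the second part in the place of `c`; inside a not-predicate, `c` is constantly true because
of the loops. For a repetition, `p R' | !(p R') ε` is true whatever the value of `R'` is, because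
both occurrences of `p R'` have the same value.

In a linear grammar nonterminals are in tail position, and what follows them is always true: it is
either the end of a not-predicate or the final repetition, which accepts every input. Hence all
occurrences of a nonterminal are continued in the same way, and its temporary variable may stand for
the initial function at the first application (`AExp.IsLinear.sound_conv`, `AExp.sound_convNT`). The
replacement of temporary variables is cut off after as many rounds as there are nonterminals. This
does no harm, since nested applications at the same position are applications of distinct
nonterminals, and all rounds are available again once some input is consumed; `AExp.Computes` keeps
track of the number of rounds left, and `AExp.Computes.eq_isSome` makes the count. Values that
depend on evaluations that do not terminate are arbitrary, but no outcome depends on them.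
-/

/-! ### Deterministic evaluation -/

namespace AExp

variable {σ M : Type*}

/-- An expression is nonterminal-free if it contains no nonterminal. -/
def NFree : AExp σ M → Prop
  | empty => True
  | char _ => True
  | nt _ => False
  | seq e₁ e₂ => e₁.NFree ∧ e₂.NFree
  | alt e₁ e₂ => e₁.NFree ∧ e₂.NFree
  | star e => e.NFree
  | not e => e.NFree

/-- Linear expressions with alternation: nonterminals occur only in tail position, either of the
whole expression or of the body of a not-predicate. -/
inductive IsLinear : AExp σ M → Prop
  | nfree {p : AExp σ M} : p.NFree → IsLinear p
  | nt (A : M) : IsLinear (nt A)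
  | seq {p e : AExp σ M} : p.NFree → IsLinear e → IsLinear (seq p e)
  | alt {e₁ e₂ : AExp σ M} : IsLinear e₁ → IsLinear e₂ → IsLinear (alt e₁ e₂)
  | notSeq {e₁ e₂ : AExp σ M} : IsLinear e₁ → IsLinear e₂ → IsLinear (seq (not e₁) e₂)

/-- A refinement of `AExp.Consume` that is deterministic and records why an evaluation terminates.
`Eval rule S e x r` says that `e` has the outcome `r` on `x` by an evaluation in which both sides of
every alternation that is met are evaluated and at most one of them succeeds, every round of a
repetition consumes something, and no nonterminal of `S` is applied before some input is consumed.
The set `S` collects the nonterminals whose evaluation began at the current position. -/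
inductive Eval [DecidableEq M] (rule : M → AExp σ M) :
    Finset M → AExp σ M → List σ → Option (List σ) → Prop
  | empty {S : Finset M} (x : List σ) : Eval rule S empty x (some [])
  | char {S : Finset M} (a : σ) (x : List σ) : Eval rule S (char a) (a :: x) (some [a])
  | char_ne {S : Finset M} {a b : σ} (x : List σ) : a ≠ b → Eval rule S (char a) (b :: x) none
  | char_nil {S : Finset M} (a : σ) : Eval rule S (char a) [] none
  | nt {S : Finset M} {A : M} {x : List σ} {r : Option (List σ)} : A ∉ S →
      Eval rule (insert A S) (rule A) x r → Eval rule S (nt A) x r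
  | seq {S S' : Finset M} {e₁ e₂ : AExp σ M} {x y w : List σ} {r r' : Option (List σ)} :
      x = y ++ w → r' = r.map (y ++ ·) → (y = [] → S ⊆ S') →
      Eval rule S e₁ x (some y) → Eval rule S' e₂ w r → Eval rule S (seq e₁ e₂) x r'
  | seq_fail {S : Finset M} {e₁ e₂ : AExp σ M} {x : List σ} :
      Eval rule S e₁ x none → Eval rule S (seq e₁ e₂) x none
  | alt_left {S : Finset M} {e₁ e₂ : AExp σ M} {x y : List σ} :
      Eval rule S e₁ x (some y) → Eval rule S e₂ x none → Eval rule S (alt e₁ e₂) x (some y)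
  | alt_right {S : Finset M} {e₁ e₂ : AExp σ M} {x : List σ} {r : Option (List σ)} :
      Eval rule S e₁ x none → Eval rule S e₂ x r → Eval rule S (alt e₁ e₂) x r
  | star_nil {S : Finset M} {e : AExp σ M} {x : List σ} :
      Eval rule S e x none → Eval rule S (star e) x (some [])
  | star_step {S : Finset M} {e : AExp σ M} {x y w z : List σ} : x = y ++ w → y ≠ [] →
      Eval rule S e x (some y) → Eval rule ∅ (star e) w (some z) →
      Eval rule S (star e) x (some (y ++ z))
  | not {S : Finset M} {e : AExp σ M} {x : List σ} :
      Eval rule S e x none → Eval rule S (not e) x (some [])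
  | not_fail {S : Finset M} {e : AExp σ M} {x y : List σ} :
      Eval rule S e x (some y) → Eval rule S (not e) x none

namespace Eval

variable [DecidableEq M] {rule : M → AExp σ M}

theorem mono {S S' : Finset M} {e : AExp σ M} {x : List σ} {r : Option (List σ)}
    (h : Eval rule S e x r) (hS : S' ⊆ S) : Eval rule S' e x r := by
  induction h generalizing S' with
  | empty x => exact .empty x
  | char a x => exact .char a x
  | char_ne x h => exact .char_ne x h
  | char_nil a => exact .char_nil a
  | nt hA _ ih => exact .nt (fun h => hA (hS h)) (ih (Finset.insert_subset_insert _ hS))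
  | seq hx hr hS' _ h₂ ih₁ _ => exact .seq hx hr (fun hy => hS.trans (hS' hy)) (ih₁ hS) h₂
  | seq_fail _ ih => exact .seq_fail (ih hS)
  | alt_left _ _ ih₁ ih₂ => exact .alt_left (ih₁ hS) (ih₂ hS)
  | alt_right _ _ ih₁ ih₂ => exact .alt_right (ih₁ hS) (ih₂ hS)
  | star_nil _ ih => exact .star_nil (ih hS)
  | star_step hx hy _ h₂ ih₁ _ => exact .star_step hx hy (ih₁ hS) h₂
  | not _ ih => exact .not (ih hS)
  | not_fail _ ih => exact .not_fail (ih hS)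

theorem consume {S : Finset M} {e : AExp σ M} {x : List σ} {r : Option (List σ)}
    (h : Eval rule S e x r) : Consume rule e x r := by
  induction h with
  | empty x => exact .empty x
  | char a x => exact .char a x
  | char_ne x h => exact .char_ne x h
  | char_nil a => exact .char_nil a
  | nt _ _ ih => exact .nt ih
  | @seq _ _ _ _ _ _ _ r _ hx hr _ _ _ ih₁ ih₂ =>
    subst hr
    cases r with
    | none => exact .seq_fail_right hx ih₁ ih₂
    | some z => exact .seq hx ih₁ ih₂
  | seq_fail _ ih => exact .seq_fail_left ih
  | alt_left _ _ ih₁ _ => exact .alt_left ih₁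
  | @alt_right _ _ _ _ r _ _ ih₁ ih₂ =>
    cases r with
    | none => exact .alt_fail ih₁ ih₂
    | some z => exact .alt_right ih₂
  | star_nil _ ih => exact Consume.star_stop ih
  | star_step hx _ _ _ ih₁ ih₂ => exact .star_step hx ih₁ ih₂
  | not _ ih => exact .not ih
  | not_fail _ ih => exact .not_fail ih

/-- An expression that is evaluated deterministically has no other outcome. -/
theorem unique {S : Finset M} {e : AExp σ M} {x : List σ} {r r' : Option (List σ)}
    (h : Eval rule S e x r) (h' : Consume rule e x r') : r = r' := by
  induction h generalizing r' with
  | empty x => cases h'; rfl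
  | char a x =>
    cases h' with
    | char => rfl
    | char_ne _ h => exact absurd rfl h
  | char_ne x h =>
    cases h' with
    | char => exact absurd rfl h
    | char_ne _ h => rfl
  | char_nil a => cases h'; rfl
  | nt _ _ ih => cases h' with | nt h' => exact ih h'
  | seq hx hr _ _ _ ih₁ ih₂ =>
    cases h' with
    | seq hx' h₁ h₂ =>
      obtain rfl := Option.some.inj (ih₁ h₁)
      obtain rfl := List.append_cancel_left (hx.symm.trans hx')
      rw [hr, ih₂ h₂]; rfl
    | seq_fail_left h₁ => exact absurd (ih₁ h₁) (by simp)
    | seq_fail_right hx' h₁ h₂ =>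
      obtain rfl := Option.some.inj (ih₁ h₁)
      obtain rfl := List.append_cancel_left (hx.symm.trans hx')
      rw [hr, ih₂ h₂]; rfl
  | seq_fail _ ih =>
    cases h' with
    | seq _ h₁ _ => exact absurd (ih h₁) (by simp)
    | seq_fail_left h₁ => rfl
    | seq_fail_right _ h₁ _ => rfl
  | alt_left _ _ ih₁ ih₂ =>
    cases h' with
    | alt_left h => exact ih₁ h
    | alt_right h => exact absurd (ih₂ h) (by simp)
    | alt_fail h _ => exact ih₁ h
  | alt_right _ _ ih₁ ih₂ =>
    cases h' with
    | alt_left h => exact absurd (ih₁ h) (by simp)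
    | alt_right h => exact ih₂ h
    | alt_fail _ h => exact ih₂ h
  | star_nil _ ih =>
    cases h' with
    | star_stop _ => rfl
    | star_step _ h _ => exact absurd (ih h) (by simp)
  | star_step hx _ _ _ ih₁ ih₂ =>
    cases h' with
    | star_stop h => exact absurd (ih₁ h) (by simp)
    | star_step hx' h₁ h₂ =>
      obtain rfl := Option.some.inj (ih₁ h₁)
      obtain rfl := List.append_cancel_left (hx.symm.trans hx')
      rw [Option.some.inj (ih₂ h₂)]
  | not _ ih =>
    cases h' with
    | not _ => rfl
    | not_fail h => exact absurd (ih h) (by simp)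
  | not_fail _ ih =>
    cases h' with
    | not h => exact absurd (ih h) (by simp)
    | not_fail _ => rfl

/-- Either `A` is not applied at the current position, or its innermost application there is an
evaluation of `A` in which `A` is not applied again at this position. -/
theorem insert_or {S : Finset M} {e : AExp σ M} {x : List σ} {r : Option (List σ)}
    (h : Eval rule S e x r) (A : M) :
    Eval rule (insert A S) e x r ∨ ∃ r', Eval rule (insert A S) (rule A) x r' := by
  induction h with
  | empty x => exact .inl (.empty x)
  | char a x => exact .inl (.char a x)
  | char_ne x h => exact .inl (.char_ne x h)
  | char_nil a => exact .inl (.char_nil a)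
  | @nt S B x r hB h ih =>
    by_cases hBA : B = A
    · subst hBA
      exact .inr ⟨r, h⟩
    · rw [Finset.insert_comm] at ih
      rcases ih with ih | ⟨r', ih⟩
      · exact .inl (.nt (by simp [hBA, hB]) ih)
      · exact .inr ⟨r', ih.mono (Finset.subset_insert _ _)⟩
  | @seq S S' e₁ e₂ x y w r r' hx hr hS h₁ h₂ ih₁ ih₂ =>
    rcases ih₁ with ih₁ | ih₁
    · by_cases hy : y = []
      · subst hy
        obtain rfl : x = w := hx
        rcases ih₂ with ih₂ | ⟨r', ih₂⟩
        · exact .inl (.seq (y := []) rfl hr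
            (fun _ => Finset.insert_subset_insert _ (hS rfl)) ih₁ ih₂)
        · exact .inr ⟨r', ih₂.mono (Finset.insert_subset_insert _ (hS rfl))⟩
      · exact .inl (.seq hx hr (fun h => absurd h hy) ih₁ h₂)
    · exact .inr ih₁
  | seq_fail _ ih => exact ih.imp_left .seq_fail
  | alt_left _ _ ih₁ ih₂ =>
    rcases ih₁ with ih₁ | ih₁
    · exact ih₂.imp_left (.alt_left ih₁)
    · exact .inr ih₁
  | alt_right _ _ ih₁ ih₂ =>
    rcases ih₁ with ih₁ | ih₁
    · exact ih₂.imp_left (.alt_right ih₁)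
    · exact .inr ih₁
  | star_nil _ ih => exact ih.imp_left .star_nil
  | star_step hx hy _ h₂ ih₁ _ => exact ih₁.imp_left fun h => .star_step hx hy h h₂
  | not _ ih => exact ih.imp_left .not
  | not_fail _ ih => exact ih.imp_left .not_fail

/-- A nonterminal need not be applied inside its own evaluation before some input is consumed,
because the evaluation is deterministic. -/
theorem nt_empty {A : M} {x : List σ} {r : Option (List σ)} (h : Eval rule ∅ (rule A) x r) :
    Eval rule ∅ (.nt A) x r := by
  refine .nt (Finset.notMem_empty A) ?_
  rcases h.insert_or A with h' | ⟨r', h'⟩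
  · exact h'
  · rwa [h.unique h'.consume]

/-- A round of a terminating repetition cannot consume the empty string. -/
theorem star_step' {e : AExp σ M} {x y w z : List σ} (hx : x = y ++ w)
    (h₁ : Eval rule ∅ e x (some y)) (h₂ : Eval rule ∅ (star e) w (some z)) :
    Eval rule ∅ (star e) x (some (y ++ z)) := by
  refine .star_step hx ?_ h₁ h₂
  rintro rfl
  obtain rfl : x = w := hx
  cases h₂ with
  | star_nil h => exact absurd (h₁.unique h.consume) (by simp)
  | star_step _ hy h _ => exact hy (Option.some.inj (h₁.unique h.consume)).symm

theorem anyOf_cons {S : Finset M} {a : σ} (x : List σ) {l : List σ} (ha : a ∈ l) :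
    Eval rule S (anyOf l) (a :: x) (some [a]) := by
  induction l with
  | nil => exact absurd ha (by simp)
  | cons b l ih =>
    cases l with
    | nil =>
      obtain rfl : a = b := by simpa using ha
      exact .char a x
    | cons c l =>
      by_cases hab : b = a
      · subst hab
        exact .alt_left (.char b x) (.seq_fail (.not_fail (.char b x)))
      · refine .alt_right (.char_ne x hab) (.seq (y := []) (S' := S) rfl rfl (fun _ => subset_rfl)
          (.not (.char_ne x hab)) (ih ?_))
        simpa [Ne.symm hab] using ha

theorem anyOf_nil {S : Finset M} (l : List σ) : Eval rule S (anyOf l) [] none := by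
  induction l with
  | nil => exact .not_fail (.empty [])
  | cons b l ih =>
    cases l with
    | nil => exact .char_nil b
    | cons c l =>
      exact .alt_right (.char_nil b) (.seq (r := none) (y := []) (S' := S) rfl rfl
        (fun _ => subset_rfl) (.not (.char_nil b)) ih)

/-- If `l` contains all terminals, then repeated consumption of any character consumes all. -/
theorem star_anyOf {l : List σ} (hl : ∀ a, a ∈ l) (x : List σ) :
    Eval rule ∅ (star (anyOf l)) x (some x) := by
  induction x with
  | nil => exact .star_nil (anyOf_nil l)
  | cons a x ih => exact .star_step (y := [a]) rfl (by simp) (anyOf_cons x (hl a)) ih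

end Eval

theorem NFree.copy {e : AExp σ M} (h : e.NFree) : e.copy.NFree := by
  unfold AExp.copy
  induction e with
  | empty => trivial
  | char a => trivial
  | nt A => exact h
  | seq e₁ e₂ ih₁ ih₂ => exact ⟨ih₁ h.1, ih₂ h.2⟩
  | alt e₁ e₂ ih₁ ih₂ => exact ⟨ih₁ h.1, ih₂ h.2⟩
  | star e ih => exact ih h
  | not e ih => exact ih h

theorem NFree.modify {e : AExp σ M} (h : e.NFree) : e.modify.NFree := by
  induction e with
  | empty => trivial
  | char a => trivial
  | nt A => exact h
  | seq e₁ e₂ ih₁ ih₂ => exact ⟨ih₁ h.1, ih₂ h.2⟩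
  | alt e₁ e₂ ih₁ ih₂ => exact ⟨ih₁ h.1, ih₂ h.2⟩
  | star e ih => exact ih h
  | not e ih => exact NFree.copy (e := e) h

theorem IsLinear.copy {e : AExp σ M} (h : e.IsLinear) : e.copy.IsLinear := by
  induction h with
  | nfree h => exact .nfree h.copy
  | nt A => exact .nt _
  | seq h _ ih => exact .seq h.copy ih
  | alt _ _ ih₁ ih₂ => exact .alt ih₁ ih₂
  | notSeq _ _ ih₁ ih₂ => exact .notSeq ih₁ ih₂

theorem IsLinear.modify {e : AExp σ M} (h : e.IsLinear) : e.modify.IsLinear := by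
  induction h with
  | nfree h => exact .nfree h.modify
  | nt A => exact .nt _
  | seq h _ ih => exact .seq h.modify ih
  | alt _ _ ih₁ ih₂ => exact .alt ih₁ ih₂
  | notSeq h _ _ ih₂ => exact .notSeq h.copy ih₂

theorem nFree_anyOf (l : List σ) : (anyOf l : AExp σ M).NFree := by
  induction l with
  | nil => trivial
  | cons b l ih =>
    cases l with
    | nil => trivial
    | cons c l => exact ⟨trivial, trivial, ih⟩

theorem anyOf_copy (l : List σ) : (anyOf l : AExp σ M).copy = anyOf l := by
  induction l with
  | nil => rfl
  | cons b l ih =>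
    cases l with
    | nil => rfl
    | cons c l => exact congrArg (fun e => AExp.alt (.char b) (.seq (.not (.char b)) e)) ih

theorem anyOf_modify (l : List σ) : (anyOf l : AExp σ M).modify = anyOf l := by
  induction l with
  | nil => rfl
  | cons b l ih =>
    cases l with
    | nil => rfl
    | cons c l => exact congrArg (fun e => AExp.alt (.char b) (.seq (.not (.char b)) e)) ih

end AExp

namespace PExp

variable {σ N : Type*}

theorem NFree.unorder {e : PExp σ N} (h : e.NFree) (l : List σ) : (e.unorder l).NFree := by
  induction e with
  | empty => trivial
  | char a => trivial
  | any => exact AExp.nFree_anyOf l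
  | nt A => exact h
  | seq e₁ e₂ ih₁ ih₂ => exact ⟨ih₁ h.1, ih₂ h.2⟩
  | choice e₁ e₂ ih₁ ih₂ => exact ⟨ih₁ h.1, ih₁ h.1, ih₂ h.2⟩
  | star e ih => exact ih h
  | not e ih => exact ih h

theorem IsLinear.unorder {e : PExp σ N} (h : e.IsLinear) (l : List σ) :
    (e.unorder l).IsLinear := by
  induction h with
  | nfree h => exact .nfree (h.unorder l)
  | nt A => exact .nt A
  | seq h _ ih => exact .seq (h.unorder l) ih
  | choice _ _ ih₁ ih₂ => exact .alt ih₁ (.notSeq ih₁ ih₂)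
  | notSeq _ _ ih₁ ih₂ => exact .notSeq ih₁ ih₂

open AExp in
/-- Every outcome of a parsing expression is an outcome, by a deterministic evaluation, of both of
its translations. A choice is translated into an alternation of which at most one side succeeds. -/
theorem Consume.eval [DecidableEq N] {l : List σ} (hl : ∀ a, a ∈ l) (G : PEG σ N)
    {e : PExp σ N} {x : List σ} {r : Option (List σ)} (h : Consume G.rule e x r) :
    Eval (G.unorder l).modify.rule ∅ (e.unorder l).modify x r ∧
      Eval (G.unorder l).modify.rule ∅ (e.unorder l).copy x r := by
  induction h with
  | empty x => exact ⟨.empty x, .empty x⟩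
  | char a x => exact ⟨.char a x, .char a x⟩
  | char_ne x h => exact ⟨.char_ne x h, .char_ne x h⟩
  | char_nil a => exact ⟨.char_nil a, .char_nil a⟩
  | any a x =>
    simp only [PExp.unorder, anyOf_copy, anyOf_modify]
    exact ⟨.anyOf_cons x (hl a), .anyOf_cons x (hl a)⟩
  | any_nil =>
    simp only [PExp.unorder, anyOf_copy, anyOf_modify]
    exact ⟨.anyOf_nil l, .anyOf_nil l⟩
  | nt _ ih => exact ⟨.nt_empty ih.1, .nt_empty ih.2⟩
  | seq hx _ _ ih₁ ih₂ =>
    exact ⟨.seq hx rfl (fun _ => subset_rfl) ih₁.1 ih₂.1,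
      .seq hx rfl (fun _ => subset_rfl) ih₁.2 ih₂.2⟩
  | seq_fail_left _ ih => exact ⟨.seq_fail ih.1, .seq_fail ih.2⟩
  | seq_fail_right hx _ _ ih₁ ih₂ =>
    exact ⟨.seq hx rfl (fun _ => subset_rfl) ih₁.1 ih₂.1,
      .seq hx rfl (fun _ => subset_rfl) ih₁.2 ih₂.2⟩
  | choice_left _ ih =>
    exact ⟨.alt_left ih.1 (.seq_fail (.not_fail ih.2)),
      .alt_left ih.2 (.seq_fail (.not_fail ih.2))⟩
  | choice_right _ _ ih₁ ih₂ =>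
    exact ⟨.alt_right ih₁.1 (.seq (y := []) rfl (by simp) (fun _ => subset_rfl) (.not ih₁.2) ih₂.1),
      .alt_right ih₁.2 (.seq (y := []) rfl (by simp) (fun _ => subset_rfl) (.not ih₁.2) ih₂.2)⟩
  | star_stop _ ih => exact ⟨.star_nil ih.1, .star_nil ih.2⟩
  | star_step hx _ _ ih₁ ih₂ => exact ⟨.star_step' hx ih₁.1 ih₂.1, .star_step' hx ih₁.2 ih₂.2⟩
  | not _ ih => exact ⟨.not ih.2, .not ih.2⟩
  | not_fail _ ih => exact ⟨.not_fail ih.2, .not_fail ih.2⟩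

end PExp

/-! ### Boolean functions -/

namespace BForm

variable {V : Type*}

theorem eval_subst (s : V → BForm V) (c : V → Bool) (f : BForm V) :
    (f.subst s).eval c = f.eval fun v => (s v).eval c := by
  induction f <;> simp_all [subst, eval]

theorem eval_congr {c c' : V → Bool} {f : BForm V} (h : ∀ v ∈ f.vars, c v = c' v) :
    f.eval c = f.eval c' := by
  induction f with
  | const b => rfl
  | var v => exact h v rfl
  | conj f g ihf ihg =>
    rw [eval, eval, ihf fun v hv => h v (.inl hv), ihg fun v hv => h v (.inr hv)]
  | disj f g ihf ihg =>
    rw [eval, eval, ihf fun v hv => h v (.inl hv), ihg fun v hv => h v (.inr hv)]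
  | neg f ih => rw [eval, eval, ih h]

theorem vars_subst_subset {s : V → BForm V} {f : BForm V} {W : Set V}
    (h : ∀ v ∈ f.vars, (s v).vars ⊆ W) : (f.subst s).vars ⊆ W := by
  induction f with
  | const b => exact Set.empty_subset _
  | var v => exact h v rfl
  | conj f g ihf ihg =>
    exact Set.union_subset (ihf fun v hv => h v (.inl hv)) (ihg fun v hv => h v (.inr hv))
  | disj f g ihf ihg =>
    exact Set.union_subset (ihf fun v hv => h v (.inl hv)) (ihg fun v hv => h v (.inr hv))
  | neg f ih => exact ih h

/-- The assignment under which `f` has the value that `φ(f, g, F)` has under `c`. -/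
def continued [DecidableEq V] (F : Finset V) (g : BForm V) (c : V → Bool) (v : V) : Bool :=
  if v ∈ F then c v || g.eval c else c v

theorem continued_of_notMem [DecidableEq V] {F : Finset V} {v : V} (h : v ∉ F) (g : BForm V)
    (c : V → Bool) : continued F g c v = c v :=
  if_neg h

theorem eval_phi [DecidableEq V] (f g : BForm V) (F : Finset V) (c : V → Bool) :
    (f.phi g F).eval c = f.eval (continued F g c) := by
  rw [phi, eval_subst]
  congr 1
  funext v
  by_cases h : v ∈ F <;> simp [h, continued, eval]

theorem vars_phi_subset [DecidableEq V] {f g : BForm V} {F : Finset V} {W : Set V}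
    (hf : f.vars ⊆ W) (hg : g.vars ⊆ W) : (f.phi g F).vars ⊆ W := by
  refine vars_subst_subset fun v hv => ?_
  have : v ∈ W := hf hv
  split <;> simp [vars, hg, this, Set.insert_subset_iff]

theorem unroll_of_none {tbl : V → Option (BForm V)} {v : V} (h : tbl v = none) (k : ℕ) :
    unroll tbl k v = var v := by
  cases k <;> simp [unroll, h]

theorem unroll_succ_of_some {tbl : V → Option (BForm V)} {v : V} {g : BForm V}
    (h : tbl v = some g) (k : ℕ) : unroll tbl (k + 1) v = g.subst (unroll tbl k) := by
  simp [unroll, h]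

/-- Unrolling eliminates all variables that have an entry in the table. -/
theorem vars_unroll_subset {tbl : V → Option (BForm V)} {W W' : Set V}
    (hW' : ∀ v ∈ W', tbl v = none → v ∈ W)
    (hsome : ∀ v g, tbl v = some g → g.vars ⊆ W') (k : ℕ) {v : V} (hv : v ∈ W') :
    (unroll tbl k v).vars ⊆ W := by
  induction k generalizing v with
  | zero =>
    cases h : tbl v with
    | none => simpa [unroll, h, vars] using hW' v hv h
    | some g => simp [unroll, h, vars]
  | succ k ih =>
    cases h : tbl v with
    | none => simpa [unroll, h, vars] using hW' v hv h
    | some g =>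
      rw [unroll_succ_of_some h]
      exact vars_subst_subset fun u hu => ih (hsome v g h hu)

end BForm

/-! ### Invariants of the construction -/

namespace PreBFA

variable {σ M : Type*}

/-- The invariants of automata under construction, as far as they do not depend on the expression:
apart from states, only variables in `R` occur; a state in `F` is not in `P` and has no transitions;
a state in `P` stays true once it is true. -/
structure Sane (R : Set (BVar M)) (B : PreBFA σ M) : Prop where
  F_subset : B.F ⊆ B.Q
  P_subset : B.P ⊆ B.Q
  notMem_P : ∀ q ∈ B.F, q ∉ B.P
  vars_f₀ : B.f₀.vars ⊆ ↑B.Q ∪ R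
  vars_δ : ∀ q a, (B.δ q a).vars ⊆ ↑B.Q ∪ R
  vars_inits : ∀ i ∈ B.inits, i.2.vars ⊆ ↑B.Q ∪ R
  dead : ∀ q, q ∉ B.Q ∨ q ∈ B.F → ∀ a c, (B.δ q a).eval c = false
  loop : ∀ q ∈ B.P, ∀ a c, c q = true → (B.δ q a).eval c = true

namespace Sane

variable {R : Set (BVar M)} {B B₁ B₂ : PreBFA σ M}

theorem mono {R' : Set (BVar M)} (h : Sane R B) (hR : R ⊆ R') : Sane R' B where
  __ := h
  vars_f₀ := h.vars_f₀.trans (Set.union_subset_union_right _ hR)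
  vars_δ q a := (h.vars_δ q a).trans (Set.union_subset_union_right _ hR)
  vars_inits i hi := (h.vars_inits i hi).trans (Set.union_subset_union_right _ hR)

theorem ofVar {v : BVar M} (hv : v ∈ R) : Sane R (ofVar v : PreBFA σ M) where
  F_subset := subset_rfl
  P_subset := subset_rfl
  notMem_P q hq := absurd hq (Finset.notMem_empty q)
  vars_f₀ := by simp [PreBFA.ofVar, BForm.vars, hv]
  vars_δ q a := by simp [PreBFA.ofVar, BForm.vars]
  vars_inits i hi := by simp [PreBFA.ofVar] at hi
  dead q _ a c := rfl
  loop q hq := absurd hq (Finset.notMem_empty q)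

theorem eps (R : Set (BVar M)) (s : ℕ) : Sane R (eps s : PreBFA σ M) where
  F_subset := subset_rfl
  P_subset := Finset.empty_subset _
  notMem_P q _ := Finset.notMem_empty q
  vars_f₀ := by simp [PreBFA.eps, BForm.vars]
  vars_δ q a := by simp [PreBFA.eps, BForm.vars]
  vars_inits i hi := by simp [PreBFA.eps] at hi
  dead q _ a c := rfl
  loop q hq := absurd hq (Finset.notMem_empty q)

/-- Substitution for variables that are not states preserves the invariants. -/
theorem substAll {R' : Set (BVar M)} {s : BVar M → BForm (BVar M)} (h : Sane R' B)
    (hQ : ∀ q ∈ B.Q, s q = .var q) (hR' : ∀ v ∈ R', (s v).vars ⊆ ↑B.Q ∪ R) :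
    Sane R (substAll s B) := by
  have hsub {f : BForm (BVar M)} (hf : f.vars ⊆ ↑B.Q ∪ R') : (f.subst s).vars ⊆ ↑B.Q ∪ R := by
    refine BForm.vars_subst_subset fun v hv => ?_
    rcases hf hv with hv | hv
    · rw [hQ v hv]
      exact Set.singleton_subset_iff.2 (.inl hv)
    · exact hR' v hv
  constructor
  · exact h.F_subset
  · exact h.P_subset
  · exact h.notMem_P
  · exact hsub h.vars_f₀
  · exact fun q a => hsub (h.vars_δ q a)
  · intro i hi
    obtain ⟨j, hj, rfl⟩ := List.mem_map.1 hi
    exact hsub (h.vars_inits j hj)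
  · intro q hq a c
    exact (BForm.eval_subst _ _ _).trans (h.dead q hq a _)
  · intro q hq a c hc
    refine (BForm.eval_subst _ _ _).trans (h.loop q hq a _ ?_)
    rwa [hQ q (h.P_subset hq)]

variable [DecidableEq M]

theorem char [DecidableEq σ] (R : Set (BVar M)) (a : σ) {s t : ℕ} (hst : s ≠ t) :
    Sane R (char a s t : PreBFA σ M) where
  F_subset := by simp [PreBFA.char]
  P_subset := Finset.empty_subset _
  notMem_P q _ := Finset.notMem_empty q
  vars_f₀ := by simp [PreBFA.char, BForm.vars]
  vars_δ q a := by
    simp only [PreBFA.char]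
    split <;> simp [BForm.vars]
  vars_inits i hi := by simp [PreBFA.char] at hi
  dead q hq b c := by
    have : q ≠ .state s := by
      rintro rfl
      simp [PreBFA.char, hst] at hq
    simp [PreBFA.char, this, BForm.eval]
  loop q hq := absurd hq (Finset.notMem_empty q)

theorem seq (h₁ : Sane R B₁) (h₂ : Sane R B₂) (hd : Disjoint B₁.Q B₂.Q) :
    Sane R (seq B₁ B₂) := by
  have hsub₁ : (↑B₁.Q ∪ R : Set (BVar M)) ⊆ ↑(B₁.Q ∪ B₂.Q) ∪ R := by
    rw [Finset.coe_union]; exact Set.union_subset_union_left _ Set.subset_union_left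
  have hsub₂ : (↑B₂.Q ∪ R : Set (BVar M)) ⊆ ↑(B₁.Q ∪ B₂.Q) ∪ R := by
    rw [Finset.coe_union]; exact Set.union_subset_union_left _ Set.subset_union_right
  rw [Finset.disjoint_left] at hd
  constructor
  · exact h₂.F_subset.trans Finset.subset_union_right
  · exact Finset.union_subset_union h₁.P_subset h₂.P_subset
  · intro q hq hqP
    rcases Finset.mem_union.1 hqP with hqP | hqP
    · exact hd (h₁.P_subset hqP) (h₂.F_subset hq)
    · exact h₂.notMem_P q hq hqP
  · exact BForm.vars_phi_subset (h₁.vars_f₀.trans hsub₁) (h₂.vars_f₀.trans hsub₂)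
  · intro q a
    exact Set.union_subset
      (BForm.vars_phi_subset ((h₁.vars_δ q a).trans hsub₁) (h₂.vars_f₀.trans hsub₂))
      ((h₂.vars_δ q a).trans hsub₂)
  · intro i hi
    rcases List.mem_append.1 hi with hi | hi
    · obtain ⟨j, hj, rfl⟩ := List.mem_map.1 hi
      exact BForm.vars_phi_subset ((h₁.vars_inits j hj).trans hsub₁) (h₂.vars_f₀.trans hsub₂)
    · exact (h₂.vars_inits i hi).trans hsub₂
  · intro q hq a c
    have hq₁ : q ∉ B₁.Q := by
      rcases hq with hq | hq
      · exact fun h => hq (Finset.mem_union_left _ h)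
      · exact fun h => hd h (h₂.F_subset hq)
    have hq₂ : q ∉ B₂.Q ∨ q ∈ B₂.F := hq.imp_left fun hq h => hq (Finset.mem_union_right _ h)
    simp [PreBFA.seq, BForm.eval, BForm.eval_phi, h₁.dead q (.inl hq₁), h₂.dead q hq₂]
  · intro q hq a c hc
    rcases Finset.mem_union.1 hq with hq | hq
    · have hqF : q ∉ B₁.F := fun h => h₁.notMem_P q h hq
      simp [PreBFA.seq, BForm.eval, BForm.eval_phi, h₁.loop q hq a (BForm.continued B₁.F B₂.f₀ c)
        (by rwa [BForm.continued_of_notMem hqF])]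
    · simp [PreBFA.seq, BForm.eval, h₂.loop q hq a c hc]

theorem alt (h₁ : Sane R B₁) (h₂ : Sane R B₂) (hd : Disjoint B₁.Q B₂.Q) :
    Sane R (alt B₁ B₂) := by
  have hsub₁ : (↑B₁.Q ∪ R : Set (BVar M)) ⊆ ↑(B₁.Q ∪ B₂.Q) ∪ R := by
    rw [Finset.coe_union]; exact Set.union_subset_union_left _ Set.subset_union_left
  have hsub₂ : (↑B₂.Q ∪ R : Set (BVar M)) ⊆ ↑(B₁.Q ∪ B₂.Q) ∪ R := by
    rw [Finset.coe_union]; exact Set.union_subset_union_left _ Set.subset_union_right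
  rw [Finset.disjoint_left] at hd
  constructor
  · exact Finset.union_subset_union h₁.F_subset h₂.F_subset
  · exact Finset.union_subset_union h₁.P_subset h₂.P_subset
  · intro q hq hqP
    rcases Finset.mem_union.1 hq with hq | hq <;> rcases Finset.mem_union.1 hqP with hqP | hqP
    · exact h₁.notMem_P q hq hqP
    · exact hd (h₁.F_subset hq) (h₂.P_subset hqP)
    · exact hd (h₁.P_subset hqP) (h₂.F_subset hq)
    · exact h₂.notMem_P q hq hqP
  · exact Set.union_subset (h₁.vars_f₀.trans hsub₁) (h₂.vars_f₀.trans hsub₂)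
  · intro q a
    exact Set.union_subset ((h₁.vars_δ q a).trans hsub₁) ((h₂.vars_δ q a).trans hsub₂)
  · intro i hi
    rcases List.mem_append.1 hi with hi | hi
    · exact (h₁.vars_inits i hi).trans hsub₁
    · exact (h₂.vars_inits i hi).trans hsub₂
  · intro q hq a c
    have hq₁ : q ∉ B₁.Q ∨ q ∈ B₁.F := by
      rcases hq with hq | hq
      · exact .inl fun h => hq (Finset.mem_union_left _ h)
      · rcases Finset.mem_union.1 hq with hq | hq
        · exact .inr hq
        · exact .inl fun h => hd h (h₂.F_subset hq)
    have hq₂ : q ∉ B₂.Q ∨ q ∈ B₂.F := by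
      rcases hq with hq | hq
      · exact .inl fun h => hq (Finset.mem_union_right _ h)
      · rcases Finset.mem_union.1 hq with hq | hq
        · exact .inl fun h => hd (h₁.F_subset hq) h
        · exact .inr hq
    simp [PreBFA.alt, BForm.eval, h₁.dead q hq₁, h₂.dead q hq₂]
  · intro q hq a c hc
    rcases Finset.mem_union.1 hq with hq | hq
    · simp [PreBFA.alt, BForm.eval, h₁.loop q hq a c hc]
    · simp [PreBFA.alt, BForm.eval, h₂.loop q hq a c hc]

theorem not (h : Sane R B) {s : ℕ} (hs : .state s ∉ B.Q) : Sane R (not s B) := by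
  have hFP : B.F ∪ B.P ⊆ B.Q := Finset.union_subset h.F_subset h.P_subset
  have hsub : (↑B.Q ∪ R : Set (BVar M)) ⊆ ↑(B.Q ∪ {.state s}) ∪ R := by
    rw [Finset.coe_union]; exact Set.union_subset_union_left _ Set.subset_union_left
  constructor
  · exact Finset.subset_union_right
  · exact hFP.trans Finset.subset_union_left
  · intro q hq hqP
    obtain rfl := Finset.mem_singleton.1 hq
    exact hs (hFP hqP)
  · refine Set.union_subset ?_ (h.vars_f₀.trans hsub)
    simp [PreBFA.not, BForm.vars]
  · intro q a
    refine Set.union_subset ((h.vars_δ q a).trans hsub) ?_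
    split
    · rename_i hq
      exact Set.singleton_subset_iff.2 (hsub (.inl (hFP hq)))
    · exact Set.empty_subset _
  · exact fun i hi => (h.vars_inits i hi).trans hsub
  · intro q hq a c
    have hqQ : q ∉ B.Q := by
      rcases hq with hq | hq
      · exact fun h => hq (Finset.mem_union_left _ h)
      · rw [Finset.mem_singleton.1 hq]
        exact hs
    have hqFP : q ∉ B.F ∪ B.P := fun h => hqQ (hFP h)
    simp only [PreBFA.not, BForm.eval, h.dead q (.inl hqQ), if_neg hqFP, Bool.or_false]
  · intro q hq a c hc
    have hq : q ∈ B.F ∪ B.P := hq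
    simp only [PreBFA.not, BForm.eval, if_pos hq, hc, Bool.or_true]

end Sane

/-- The states are numbered from `lo` up to `hi - 1`. -/
def InRange (lo hi : ℕ) (Q : Finset (BVar M)) : Prop :=
  ∀ q ∈ Q, ∃ n, q = .state n ∧ lo ≤ n ∧ n < hi

theorem InRange.mono {lo hi lo' hi' : ℕ} {Q : Finset (BVar M)} (h : InRange lo hi Q)
    (hlo : lo' ≤ lo) (hhi : hi ≤ hi') : InRange lo' hi' Q := by
  intro q hq
  obtain ⟨n, rfl, h₁, h₂⟩ := h q hq
  exact ⟨n, rfl, hlo.trans h₁, h₂.trans_le hhi⟩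

theorem InRange.singleton {lo hi n : ℕ} (h₁ : lo ≤ n) (h₂ : n < hi) :
    InRange lo hi ({.state n} : Finset (BVar M)) := by
  intro q hq
  exact ⟨n, Finset.mem_singleton.1 hq, h₁, h₂⟩

theorem InRange.notMem {lo hi n : ℕ} {Q : Finset (BVar M)} (h : InRange lo hi Q)
    (hn : n < lo ∨ hi ≤ n) : .state n ∉ Q := by
  intro hq
  obtain ⟨m, hm, h₁, h₂⟩ := h _ hq
  obtain rfl : n = m := by simpa using hm
  omega

theorem InRange.disjoint {lo hi lo' hi' : ℕ} {Q Q' : Finset (BVar M)} (h : InRange lo hi Q)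
    (h' : InRange lo' hi' Q') (hle : hi ≤ lo') : Disjoint Q Q' := by
  rw [Finset.disjoint_left]
  intro q hq
  obtain ⟨n, rfl, h₁, h₂⟩ := h q hq
  exact h'.notMem (by omega)

variable [DecidableEq M]

/-- `X` in the definition of `star`, the conversion of the rule of `R'`. -/
def starX (r' s₃ s₄ : ℕ) (B₃ B₄ : PreBFA σ M) : PreBFA σ M :=
  alt (seq B₃ (ofVar (.state r'))) (seq (not s₃ (seq B₄ (ofVar (.state r')))) (eps s₄))

/-- `Y` in the definition of `star`, the conversion of the rule of `R`. -/
def starY (r s₁ s₂ : ℕ) (X B₁ B₂ : PreBFA σ M) : PreBFA σ M :=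
  alt (seq B₁ (ofVar (.state r))) (seq (not s₁ (seq B₂ X)) (eps s₂))

/-- The table of the temporary variables `r` and `r'` in the definition of `star`. -/
def starTbl (r r' : ℕ) (X Y : PreBFA σ M) (v : BVar M) : Option (BForm (BVar M)) :=
  if v = .state r then some Y.f₀ else if v = .state r' then some X.f₀ else none

theorem star_eq (r r' s₁ s₂ s₃ s₄ : ℕ) (B₁ B₂ B₃ B₄ : PreBFA σ M) :
    star r r' s₁ s₂ s₃ s₄ B₁ B₂ B₃ B₄ =
      (starY r s₁ s₂ (starX r' s₃ s₄ B₃ B₄) B₁ B₂).substAll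
        (BForm.unroll (starTbl r r' (starX r' s₃ s₄ B₃ B₄)
          (starY r s₁ s₂ (starX r' s₃ s₄ B₃ B₄) B₁ B₂)) 2) :=
  rfl

theorem InRange.union {lo hi : ℕ} {Q Q' : Finset (BVar M)} (h : InRange lo hi Q)
    (h' : InRange lo hi Q') : InRange lo hi (Q ∪ Q') := by
  intro q hq
  rcases Finset.mem_union.1 hq with hq | hq
  exacts [h q hq, h' q hq]

/-- Disjointness of the state sets that `star` puts together. -/
structure StarDisjoint (r r' s₁ s₂ s₃ s₄ : ℕ) (B₁ B₂ B₃ B₄ : PreBFA σ M) : Prop where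
  nodup : [r, r', s₁, s₂, s₃, s₄].Nodup
  notMem : ∀ s ∈ [r, r', s₁, s₂, s₃, s₄], BVar.state s ∉ B₁.Q ∧ BVar.state s ∉ B₂.Q ∧
    BVar.state s ∉ B₃.Q ∧ BVar.state s ∉ B₄.Q
  d₁₂ : Disjoint B₁.Q B₂.Q
  d₁₃ : Disjoint B₁.Q B₃.Q
  d₁₄ : Disjoint B₁.Q B₄.Q
  d₂₃ : Disjoint B₂.Q B₃.Q
  d₂₄ : Disjoint B₂.Q B₄.Q
  d₃₄ : Disjoint B₃.Q B₄.Q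

namespace StarDisjoint

variable {r r' s₁ s₂ s₃ s₄ : ℕ} {B₁ B₂ B₃ B₄ : PreBFA σ M}

/-- The disjointness conditions for the operations that make up `X` and `Y`. -/
theorem conditions (h : StarDisjoint r r' s₁ s₂ s₃ s₄ B₁ B₂ B₃ B₄) :
    (.state s₃ ∉ (seq B₄ (ofVar (.state r'))).Q ∧
      Disjoint (not s₃ (seq B₄ (ofVar (.state r')))).Q (eps s₄ : PreBFA σ M).Q ∧
      Disjoint (seq B₃ (ofVar (.state r'))).Q
        (seq (not s₃ (seq B₄ (ofVar (.state r')))) (eps s₄)).Q) ∧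
    Disjoint B₂.Q (starX r' s₃ s₄ B₃ B₄).Q ∧
    (.state s₁ ∉ (seq B₂ (starX r' s₃ s₄ B₃ B₄)).Q ∧
      Disjoint (not s₁ (seq B₂ (starX r' s₃ s₄ B₃ B₄))).Q (eps s₂ : PreBFA σ M).Q ∧
      Disjoint (seq B₁ (ofVar (.state r))).Q
        (seq (not s₁ (seq B₂ (starX r' s₃ s₄ B₃ B₄))) (eps s₂)).Q) ∧
    .state r ∉ (starY r s₁ s₂ (starX r' s₃ s₄ B₃ B₄) B₁ B₂).Q ∧
    .state r' ∉ (starY r s₁ s₂ (starX r' s₃ s₄ B₃ B₄) B₁ B₂).Q := by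
  obtain ⟨hn, hm, h₁₂, h₁₃, h₁₄, h₂₃, h₂₄, h₃₄⟩ := h
  simp only [List.nodup_cons, List.mem_cons, List.not_mem_nil, or_false, not_or, forall_eq_or_imp,
    forall_eq] at hn hm
  simp only [starX, starY, PreBFA.seq, PreBFA.not, PreBFA.eps, PreBFA.ofVar, PreBFA.alt,
    Finset.union_empty, Finset.disjoint_union_right, Finset.disjoint_singleton_right,
    Finset.mem_union, Finset.mem_singleton, BVar.state.injEq, not_or]
  simp [hn, hm, h₁₂, h₁₃, h₁₄, h₂₃, h₂₄, h₃₄, eq_comm]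

end StarDisjoint

section

variable {r r' s₁ s₂ s₃ s₄ : ℕ} {B₁ B₂ B₃ B₄ : PreBFA σ M} {R : Set (BVar M)}

theorem Sane.starX (hd : StarDisjoint r r' s₁ s₂ s₃ s₄ B₁ B₂ B₃ B₄) (h₃ : Sane R B₃)
    (h₄ : Sane R B₄) (hr' : .state r' ∈ R) : Sane R (starX r' s₃ s₄ B₃ B₄) :=
  have hc := hd.conditions
  ((h₃.seq (.ofVar hr') (Finset.disjoint_empty_right _)).alt
    (((h₄.seq (.ofVar hr') (Finset.disjoint_empty_right _)).not hc.1.1).seq (.eps R s₄) hc.1.2.1)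
    hc.1.2.2)

theorem Sane.starY (hd : StarDisjoint r r' s₁ s₂ s₃ s₄ B₁ B₂ B₃ B₄) (h₁ : Sane R B₁)
    (h₂ : Sane R B₂) (h₃ : Sane R B₃) (h₄ : Sane R B₄) (hr : .state r ∈ R) (hr' : .state r' ∈ R) :
    Sane R (starY r s₁ s₂ (PreBFA.starX r' s₃ s₄ B₃ B₄) B₁ B₂) :=
  have hc := hd.conditions
  ((h₁.seq (.ofVar hr) (Finset.disjoint_empty_right _)).alt
    (((h₂.seq (.starX hd h₃ h₄ hr') hc.2.1).not hc.2.2.1.1).seq (.eps R s₂) hc.2.2.1.2.1)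
    hc.2.2.1.2.2)

theorem starX_Q_subset_starY_Q {X : PreBFA σ M} : X.Q ⊆ (PreBFA.starY r s₁ s₂ X B₁ B₂).Q := by
  intro q hq
  simp [PreBFA.starY, PreBFA.seq, PreBFA.alt, PreBFA.not, hq]

theorem Sane.star (hd : StarDisjoint r r' s₁ s₂ s₃ s₄ B₁ B₂ B₃ B₄) (h₁ : Sane R B₁)
    (h₂ : Sane R B₂) (h₃ : Sane R B₃) (h₄ : Sane R B₄) :
    Sane R (star r r' s₁ s₂ s₃ s₄ B₁ B₂ B₃ B₄) := by
  rw [star_eq]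
  set X := PreBFA.starX r' s₃ s₄ B₃ B₄ with hX
  set Y := PreBFA.starY r s₁ s₂ X B₁ B₂ with hY
  set R' : Set (BVar M) := R ∪ {.state r, .state r'} with hR'
  have hr : BVar.state r ∈ R' := by simp [hR']
  have hr' : BVar.state r' ∈ R' := by simp [hR']
  have hsub : R ⊆ R' := Set.subset_union_left
  have hXs : Sane R' X := .starX hd (h₃.mono hsub) (h₄.mono hsub) hr'
  have hYs : Sane R' Y :=
    .starY hd (h₁.mono hsub) (h₂.mono hsub) (h₃.mono hsub) (h₄.mono hsub) hr hr'
  obtain ⟨-, -, -, hrY, hrY'⟩ := hd.conditions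
  refine hYs.substAll (R := R) (fun q hq => ?_) (fun v hv => ?_)
  · refine BForm.unroll_of_none ?_ 2
    have h₁ : q ≠ .state r := fun h => hrY (h ▸ hq)
    have h₂ : q ≠ .state r' := fun h => hrY' (h ▸ hq)
    simp [starTbl, h₁, h₂]
  · refine BForm.vars_unroll_subset (W' := ↑Y.Q ∪ R') (fun v hv htbl => ?_)
      (fun v g hg => ?_) 2 (.inr hv)
    · rcases hv with hv | hv | rfl | rfl
      · exact .inl hv
      · exact .inr hv
      · simp [starTbl] at htbl
      · by_cases h : r' = r <;> simp [starTbl, h] at htbl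
    · simp only [starTbl] at hg
      split_ifs at hg
      · obtain rfl := Option.some.inj hg
        exact hYs.vars_f₀
      · obtain rfl := Option.some.inj hg
        exact hXs.vars_f₀.trans (Set.union_subset_union_left _
          (Finset.coe_subset.2 starX_Q_subset_starY_Q))

end

end PreBFA

/-! ### Invariants of `T` -/

/-- While the list of applied nonterminals grows from `l` to `l'`, the nonterminals `K` are
expanded. -/
structure Expanded {M : Type*} (l l' K : List M) : Prop where
  subset : l ⊆ l'
  nodup : K.Nodup
  notMem : ∀ A ∈ K, A ∉ l
  mem : ∀ A ∈ K, A ∈ l'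

namespace Expanded

variable {M : Type*} {l l' l'' K K' : List M}

theorem refl (l : List M) : Expanded l l [] :=
  ⟨List.Subset.refl l, List.nodup_nil, by simp, by simp⟩

theorem append (h : Expanded l l' K) (h' : Expanded l' l'' K') : Expanded l l'' (K ++ K') where
  subset _ hA := h'.subset (h.subset hA)
  nodup := h.nodup.append h'.nodup fun A hA hA' => h'.notMem A hA' (h.mem A hA)
  notMem A hA := by
    rcases List.mem_append.1 hA with hA | hA
    · exact h.notMem A hA
    · exact fun hl => h'.notMem A hA (h.subset hl)
  mem A hA := by
    rcases List.mem_append.1 hA with hA | hA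
    · exact h'.subset (h.mem A hA)
    · exact h'.mem A hA

theorem cons {A : M} (h : Expanded (A :: l) l' K) (hA : A ∉ l) : Expanded l l' (A :: K) where
  subset := fun _ hB => h.subset (List.mem_cons_of_mem A hB)
  nodup := List.nodup_cons.2 ⟨fun hK => h.notMem A hK List.mem_cons_self, h.nodup⟩
  notMem B hB := by
    rcases List.mem_cons.1 hB with rfl | hB
    · exact hA
    · exact fun hl => h.notMem B hB (List.mem_cons_of_mem A hl)
  mem B hB := by
    rcases List.mem_cons.1 hB with rfl | hB
    · exact h.subset List.mem_cons_self
    · exact h.mem B hB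

end Expanded

/-- The invariants of `T`, for a conversion that starts in `S` with the result `res`. -/
structure Built {σ M : Type*} (S : TState M) (res : PreBFA σ M × TState M) : Prop where
  next_le : S.next ≤ res.2.next
  inRange : PreBFA.InRange S.next res.2.next res.1.Q
  sane : PreBFA.Sane (Set.range BVar.tmp) res.1
  expanded : Expanded S.applied res.2.applied (res.1.inits.map Prod.fst)

theorem Built.ofVar_tmp {σ M : Type*} (A : M) (S : TState M) :
    Built S ((.ofVar (.tmp A), S) : PreBFA σ M × TState M) :=
  ⟨le_rfl, fun q hq => by simp [PreBFA.ofVar] at hq, .ofVar ⟨A, rfl⟩, .refl _⟩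

namespace AExp

open PreBFA (InRange)

variable {σ M : Type*}

theorem starDisjoint_of_built {S : TState M} {R₁ R₂ R₃ R₄ : PreBFA σ M × TState M}
    (h₁ : Built { S with next := S.next + 6 } R₁) (h₂ : Built R₁.2 R₂) (h₃ : Built R₂.2 R₃)
    (h₄ : Built R₃.2 R₄) :
    PreBFA.StarDisjoint S.next (S.next + 1) (S.next + 2) (S.next + 3) (S.next + 4) (S.next + 5)
      R₁.1 R₂.1 R₃.1 R₄.1 := by
  have l₁ : S.next + 6 ≤ R₁.2.next := h₁.next_le
  have l₂ := h₂.next_le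
  have l₃ := h₃.next_le
  have r₁ : InRange (S.next + 6) _ _ := h₁.inRange
  constructor
  · simp
  · intro s hs
    have : s < S.next + 6 := by
      simp at hs
      omega
    exact ⟨r₁.notMem (by omega), h₂.inRange.notMem (by omega),
      h₃.inRange.notMem (by omega), h₄.inRange.notMem (by omega)⟩
  · exact r₁.disjoint h₂.inRange le_rfl
  · exact r₁.disjoint h₃.inRange (by omega)
  · exact r₁.disjoint h₄.inRange (by omega)
  · exact h₂.inRange.disjoint h₃.inRange le_rfl
  · exact h₂.inRange.disjoint h₄.inRange (by omega)
  · exact h₃.inRange.disjoint h₄.inRange le_rfl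

variable [DecidableEq σ] [DecidableEq M]

theorem built_conv {call : M → TState M → PreBFA σ M × TState M}
    (hcall : ∀ A S, Built S (call A S)) (e : AExp σ M) (S : TState M) :
    Built S (conv call e S) := by
  induction e generalizing S with
  | empty =>
    exact ⟨Nat.le_succ _, .singleton le_rfl (Nat.lt_succ_self _), .eps _ _, .refl _⟩
  | char a =>
    exact ⟨Nat.le_add_right _ _, (InRange.singleton le_rfl (by simp [conv])).union
      (.singleton (Nat.le_succ _) (by simp [conv])), .char _ a (Nat.succ_ne_self _).symm, .refl _⟩
  | nt A => exact hcall A S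
  | seq e₁ e₂ ih₁ ih₂ =>
    have h₁ := ih₁ S
    have h₂ := ih₂ (conv call e₁ S).2
    refine ⟨h₁.next_le.trans h₂.next_le, (h₁.inRange.mono le_rfl h₂.next_le).union
      (h₂.inRange.mono h₁.next_le le_rfl), h₁.sane.seq h₂.sane
      (h₁.inRange.disjoint h₂.inRange le_rfl), ?_⟩
    simpa [conv, PreBFA.seq, Function.comp_def] using h₁.expanded.append h₂.expanded
  | alt e₁ e₂ ih₁ ih₂ =>
    have h₁ := ih₁ S
    have h₂ := ih₂ (conv call e₁ S).2
    refine ⟨h₁.next_le.trans h₂.next_le, (h₁.inRange.mono le_rfl h₂.next_le).union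
      (h₂.inRange.mono h₁.next_le le_rfl), h₁.sane.alt h₂.sane
      (h₁.inRange.disjoint h₂.inRange le_rfl), ?_⟩
    simpa [conv, PreBFA.alt] using h₁.expanded.append h₂.expanded
  | star e ih =>
    set n := S.next with hn
    have h₁ := ih { S with next := n + 6 }
    set R₁ := conv call e { S with next := n + 6 } with hR₁
    have h₂ := ih R₁.2
    set R₂ := conv call e R₁.2 with hR₂
    have h₃ := ih R₂.2
    set R₃ := conv call e R₂.2 with hR₃
    have h₄ := ih R₃.2
    set R₄ := conv call e R₃.2 with hR₄
    have l₁ : n + 6 ≤ R₁.2.next := h₁.next_le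
    have l₂ := h₂.next_le
    have l₃ := h₃.next_le
    have l₄ := h₄.next_le
    have r₁ : InRange (n + 6) _ _ := h₁.inRange
    have hd : PreBFA.StarDisjoint n (n + 1) (n + 2) (n + 3) (n + 4) (n + 5)
        R₁.1 R₂.1 R₃.1 R₄.1 := starDisjoint_of_built h₁ h₂ h₃ h₄
    have hconv : conv call (star e) S =
      (.star n (n + 1) (n + 2) (n + 3) (n + 4) (n + 5) R₁.1 R₂.1 R₃.1 R₄.1, R₄.2) := rfl
    rw [hconv]
    refine ⟨?_, ?_, .star hd h₁.sane h₂.sane h₃.sane h₄.sane, ?_⟩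
    · change n ≤ R₄.2.next
      omega
    · have q₁ : InRange n R₄.2.next R₁.1.Q := r₁.mono (by omega) (by omega)
      have q₂ : InRange n R₄.2.next R₂.1.Q := h₂.inRange.mono (by omega) (by omega)
      have q₃ : InRange n R₄.2.next R₃.1.Q := h₃.inRange.mono (by omega) (by omega)
      have q₄ : InRange n R₄.2.next R₄.1.Q := h₄.inRange.mono (by omega) le_rfl
      have q (i : ℕ) (hi : i < 6) : InRange n R₄.2.next ({.state (n + i)} : Finset (BVar M)) :=
        .singleton (by omega) (by omega)
      have e : InRange n R₄.2.next (∅ : Finset (BVar M)) := fun q hq => by simp at hq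
      exact ((q₁.union e).union (((q₂.union ((q₃.union e).union (((q₄.union e).union
        (q 4 (by simp))).union (q 5 (by simp))))).union (q 2 (by simp))).union (q 3 (by simp))))
    · have := h₁.expanded.append (h₂.expanded.append (h₃.expanded.append h₄.expanded))
      simpa [PreBFA.star, PreBFA.substAll, PreBFA.alt, PreBFA.seq, PreBFA.not, PreBFA.eps,
        PreBFA.ofVar, Function.comp_def] using this
  | not e ih =>
    have h := ih { S with next := S.next + 1 }
    have hle : S.next + 1 ≤ _ := h.next_le
    exact ⟨(Nat.le_succ _).trans hle, (h.inRange.mono (Nat.le_succ _) le_rfl).union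
      (.singleton le_rfl hle), h.sane.not (h.inRange.notMem (.inl (Nat.lt_succ_self _))),
      h.expanded⟩

theorem starDisjoint_conv {call : M → TState M → PreBFA σ M × TState M}
    (hcall : ∀ A S, Built S (call A S)) (e : AExp σ M) (S : TState M) :
    let R₁ := conv call e { S with next := S.next + 6 }
    let R₂ := conv call e R₁.2
    let R₃ := conv call e R₂.2
    let R₄ := conv call e R₃.2
    PreBFA.StarDisjoint S.next (S.next + 1) (S.next + 2) (S.next + 3) (S.next + 4) (S.next + 5)
      R₁.1 R₂.1 R₃.1 R₄.1 :=
  starDisjoint_of_built (built_conv hcall e _) (built_conv hcall e _) (built_conv hcall e _)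
    (built_conv hcall e _)

theorem built_convNT (rule : M → AExp σ M) (k : ℕ) (A : M) (S : TState M) :
    Built S (convNT rule k A S) := by
  induction k generalizing A S with
  | zero => exact Built.ofVar_tmp A S
  | succ k ih =>
    rw [convNT]
    split_ifs with hA
    · exact Built.ofVar_tmp A S
    · have h := built_conv ih (rule A) { S with applied := A :: S.applied }
      exact ⟨h.next_le, h.inRange,
        { h.sane with
          vars_inits := fun i hi => by
            rcases List.mem_cons.1 hi with rfl | hi
            exacts [h.sane.vars_f₀, h.sane.vars_inits i hi] },
        h.expanded.cons hA⟩

/-- With enough fuel, an application of `A` makes `A` an applied nonterminal. -/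
theorem mem_applied_convNT [Fintype M] (rule : M → AExp σ M) (k : ℕ) (A : M) (S : TState M)
    (hk : Fintype.card M ≤ k + S.applied.toFinset.card) :
    A ∈ (convNT rule k A S).2.applied := by
  cases k with
  | zero =>
    have : S.applied.toFinset = Finset.univ :=
      Finset.eq_univ_of_card _ (le_antisymm (Finset.card_le_univ _) (by simpa using hk))
    exact List.mem_toFinset.1 (this.ge (Finset.mem_univ A))
  | succ k =>
    rw [convNT]
    split_ifs with hA
    · exact hA
    · exact (built_conv (built_convNT rule k) (rule A)
        { S with applied := A :: S.applied }).expanded.subset List.mem_cons_self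

theorem NFree.applied_conv {p : AExp σ M} (hp : p.NFree)
    (call : M → TState M → PreBFA σ M × TState M) (S : TState M) :
    (conv call p S).2.applied = S.applied := by
  induction p generalizing S with
  | empty => rfl
  | char a => rfl
  | nt A => exact hp.elim
  | seq e₁ e₂ ih₁ ih₂ => exact (ih₂ hp.2 _).trans (ih₁ hp.1 S)
  | alt e₁ e₂ ih₁ ih₂ => exact (ih₂ hp.2 _).trans (ih₁ hp.1 S)
  | star e ih => exact (ih hp _).trans ((ih hp _).trans ((ih hp _).trans (ih hp _)))
  | not e ih => exact ih hp _

end AExp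

/-! ### Values of states and correct initial functions -/

/-- The value of an expression with the outcome `r` on `x`, if it is continued by something that
has the value `c w` on a remaining input `w`. The value `b` is used when nothing is consumed. -/
def outcome {σ : Type*} (b : Bool) (c : List σ → Bool) (x : List σ) : Option (List σ) → Bool
  | none => false
  | some y => if y = [] then b else c (x.drop y.length)

theorem outcome_true {σ : Type*} (x : List σ) (r : Option (List σ)) :
    outcome true (fun _ => true) x r = r.isSome := by
  cases r <;> simp [outcome]

theorem outcome_append {σ : Type*} (b : Bool) (c : List σ → Bool) {y : List σ} (hy : y ≠ [])
    (w : List σ) (r : Option (List σ)) :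
    outcome b c (y ++ w) (r.map (y ++ ·)) = outcome (c w) c w r := by
  cases r with
  | none => rfl
  | some z =>
    by_cases hz : z = []
    · simp [outcome, hy, hz]
    · simp [outcome, hy, hz]

namespace PreBFA

open BForm (continued continued_of_notMem eval_phi)

variable {σ M : Type*}

/-- `V x q` is a possible value of the state `q` of `B` on the remaining input `x` in an automaton
of which `B` is a part: states in `P` are true, states in `F` have the value `c x` of what follows
`B`, and the other states obey the transitions of `B`. -/
structure Models (V : List σ → BVar M → Bool) (B : PreBFA σ M) (c : List σ → Bool) : Prop where
  F : ∀ x, ∀ q ∈ B.F, V x q = c x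
  P : ∀ x, ∀ q ∈ B.P, V x q = true
  nil : ∀ q ∈ B.Q, q ∉ B.F → q ∉ B.P → V [] q = false
  cons : ∀ q ∈ B.Q, q ∉ B.F → q ∉ B.P → ∀ a x, V (a :: x) q = (B.δ q a).eval (V x)

/-- The assignment `U` has the values given by `V` on the states of `B` outside `F`, and the value
`b` on those in `F`. -/
structure Local (U : BVar M → Bool) (b : Bool) (V : BVar M → Bool) (B : PreBFA σ M) : Prop where
  F : ∀ q ∈ B.F, U q = b
  Q : ∀ q ∈ B.Q, q ∉ B.F → U q = V q

theorem Models.local {V : List σ → BVar M → Bool} {B : PreBFA σ M} {c : List σ → Bool}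
    (hV : Models V B c) (x : List σ) : Local (V x) (c x) (V x) B :=
  ⟨hV.F x, fun _ _ _ => rfl⟩

/-- The initial function of `B` has the value that the outcome of `p` requires. The assignment `U`
at the current position is independent of `V` on variables that are not states and on the states in
`F`; this is where incompletely unrolled temporary variables come in. -/
def Correct [DecidableEq M] (rule : M → AExp σ M) (p : AExp σ M) (B : PreBFA σ M) : Prop :=
  ∀ V c, Models V B c → ∀ S x r, AExp.Eval rule S p x r → ∀ U b, Local U b (V x) B →
    B.f₀.eval U = outcome b c x r

variable [DecidableEq M] {rule : M → AExp σ M} {R : Set (BVar M)} {B B₁ B₂ : PreBFA σ M}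
  {V : List σ → BVar M → Bool} {c : List σ → Bool}

/-! ### Sequences -/

theorem Models.seq_dead (hV : Models V (seq B₁ B₂) c) (h₁ : Sane R B₁) (h₂ : Sane R B₂)
    (hd : Disjoint B₁.Q B₂.Q) {q : BVar M} (hq : q ∈ B₁.F) (x : List σ) : V x q = false := by
  have hq₁ : q ∈ B₁.Q := h₁.F_subset hq
  have hq₂ : q ∉ B₂.Q := Finset.disjoint_left.1 hd hq₁
  have hQ : q ∈ (seq B₁ B₂).Q := Finset.mem_union_left _ hq₁
  have hF : q ∉ (seq B₁ B₂).F := fun h => hq₂ (h₂.F_subset h)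
  have hP : q ∉ (seq B₁ B₂).P := fun h => by
    rcases Finset.mem_union.1 h with h | h
    exacts [h₁.notMem_P q hq h, hq₂ (h₂.P_subset h)]
  cases x with
  | nil => exact hV.nil q hQ hF hP
  | cons a x =>
    rw [hV.cons q hQ hF hP]
    simp [seq, BForm.eval, eval_phi, h₁.dead q (.inr hq), h₂.dead q (.inl hq₂)]

theorem Models.seq_left (hV : Models V (seq B₁ B₂) c) (h₁ : Sane R B₁) (h₂ : Sane R B₂)
    (hd : Disjoint B₁.Q B₂.Q) :
    Models (fun x => continued B₁.F B₂.f₀ (V x)) B₁ (fun x => B₂.f₀.eval (V x)) := by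
  have key {q : BVar M} (hq : q ∈ B₁.Q) (hqF : q ∉ B₁.F) (hqP : q ∉ B₁.P) :
      q ∈ (seq B₁ B₂).Q ∧ q ∉ (seq B₁ B₂).F ∧ q ∉ (seq B₁ B₂).P := by
    have hq₂ : q ∉ B₂.Q := Finset.disjoint_left.1 hd hq
    refine ⟨Finset.mem_union_left _ hq, fun h => hq₂ (h₂.F_subset h), fun h => ?_⟩
    rcases Finset.mem_union.1 h with h | h
    exacts [hqP h, hq₂ (h₂.P_subset h)]
  constructor
  · intro x q hq
    simp [continued, hq, hV.seq_dead h₁ h₂ hd hq]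
  · intro x q hq
    have hqF : q ∉ B₁.F := fun h => h₁.notMem_P q h hq
    simpa [continued, hqF] using hV.P x q (Finset.mem_union_left _ hq)
  · intro q hq hqF hqP
    obtain ⟨hQ, hF, hP⟩ := key hq hqF hqP
    simpa [continued, hqF] using hV.nil q hQ hF hP
  · intro q hq hqF hqP a x
    obtain ⟨hQ, hF, hP⟩ := key hq hqF hqP
    have hq₂ : q ∉ B₂.Q := Finset.disjoint_left.1 hd hq
    rw [continued_of_notMem hqF, hV.cons q hQ hF hP]
    simp [seq, BForm.eval, eval_phi, h₂.dead q (.inl hq₂)]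

theorem Models.seq_right (hV : Models V (seq B₁ B₂) c) (h₁ : Sane R B₁)
    (hd : Disjoint B₁.Q B₂.Q) : Models V B₂ c := by
  have key {q : BVar M} (hq : q ∈ B₂.Q) (hqP : q ∉ B₂.P) :
      q ∈ (seq B₁ B₂).Q ∧ q ∉ (seq B₁ B₂).P := by
    refine ⟨Finset.mem_union_right _ hq, fun h => ?_⟩
    rcases Finset.mem_union.1 h with h | h
    exacts [Finset.disjoint_left.1 hd (h₁.P_subset h) hq, hqP h]
  constructor
  · exact hV.F
  · exact fun x q hq => hV.P x q (Finset.mem_union_right _ hq)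
  · intro q hq hqF hqP
    exact hV.nil q (key hq hqP).1 hqF (key hq hqP).2
  · intro q hq hqF hqP a x
    have hq₁ : q ∉ B₁.Q := fun h => Finset.disjoint_left.1 hd h hq
    rw [hV.cons q (key hq hqP).1 hqF (key hq hqP).2]
    simp [seq, BForm.eval, eval_phi, h₁.dead q (.inl hq₁)]

/-- In a sequence the first automaton is continued by the initial function of the second one. -/
theorem Correct.eval_seq {p : AExp σ M} (hp : Correct rule p B₁) (h₁ : Sane R B₁)
    (h₂ : Sane R B₂) (hd : Disjoint B₁.Q B₂.Q) (hV : Models V (seq B₁ B₂) c) {S : Finset M}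
    {x : List σ} {r : Option (List σ)} (hr : AExp.Eval rule S p x r) {U : BVar M → Bool}
    (hU : ∀ q ∈ B₁.Q, U q = V x q) :
    (seq B₁ B₂).f₀.eval U = outcome (B₂.f₀.eval U) (fun w => B₂.f₀.eval (V w)) x r := by
  refine (eval_phi _ _ _ _).trans (hp _ _ (hV.seq_left h₁ h₂ hd) S x r hr _ _ ⟨?_, ?_⟩)
  · intro q hq
    simp [continued, hq, hU q (h₁.F_subset hq), hV.seq_dead h₁ h₂ hd hq]
  · intro q hq hqF
    simp [continued, hqF, hU q hq]

theorem Local.seq_left {U V : BVar M → Bool} {b : Bool} (hU : Local U b V (seq B₁ B₂))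
    (h₂ : Sane R B₂) (hd : Disjoint B₁.Q B₂.Q) : ∀ q ∈ B₁.Q, U q = V q := fun q hq =>
  hU.Q q (Finset.mem_union_left _ hq) fun h => Finset.disjoint_left.1 hd hq (h₂.F_subset h)

theorem Local.seq_right {U V : BVar M → Bool} {b : Bool} (hU : Local U b V (seq B₁ B₂)) :
    Local U b V B₂ :=
  ⟨hU.F, fun q hq => hU.Q q (Finset.mem_union_right _ hq)⟩

theorem Correct.seq {e₁ e₂ : AExp σ M} (he₁ : Correct rule e₁ B₁) (he₂ : Correct rule e₂ B₂)
    (h₁ : Sane R B₁) (h₂ : Sane R B₂) (hd : Disjoint B₁.Q B₂.Q) :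
    Correct rule (.seq e₁ e₂) (seq B₁ B₂) := by
  intro V c hV S x r hr U b hU
  have hV₂ := hV.seq_right h₁ hd
  cases hr with
  | seq hx hr' _ hr₁ hr₂ =>
    rename_i y w r₂ hS
    rw [he₁.eval_seq h₁ h₂ hd hV hr₁ (hU.seq_left h₂ hd)]
    subst hr' hx
    by_cases hy : y = []
    · subst hy
      rw [outcome, if_pos rfl, he₂ V c hV₂ _ _ _ hr₂ U b hU.seq_right]
      simp
    · rw [outcome_append _ _ hy, outcome, if_neg hy, List.drop_left,
        he₂ V c hV₂ _ _ _ hr₂ _ _ (hV₂.local w)]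
  | seq_fail hr₁ => exact he₁.eval_seq h₁ h₂ hd hV hr₁ (hU.seq_left h₂ hd)

/-! ### Alternations -/

theorem Models.alt_left (hV : Models V (alt B₁ B₂) c) (h₂ : Sane R B₂)
    (hd : Disjoint B₁.Q B₂.Q) : Models V B₁ c := by
  have key {q : BVar M} (hq : q ∈ B₁.Q) (hqF : q ∉ B₁.F) (hqP : q ∉ B₁.P) :
      q ∈ (alt B₁ B₂).Q ∧ q ∉ (alt B₁ B₂).F ∧ q ∉ (alt B₁ B₂).P := by
    have hq₂ : q ∉ B₂.Q := Finset.disjoint_left.1 hd hq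
    exact ⟨Finset.mem_union_left _ hq,
      fun h => (Finset.mem_union.1 h).elim hqF fun h => hq₂ (h₂.F_subset h),
      fun h => (Finset.mem_union.1 h).elim hqP fun h => hq₂ (h₂.P_subset h)⟩
  constructor
  · exact fun x q hq => hV.F x q (Finset.mem_union_left _ hq)
  · exact fun x q hq => hV.P x q (Finset.mem_union_left _ hq)
  · intro q hq hqF hqP
    obtain ⟨hQ, hF, hP⟩ := key hq hqF hqP
    exact hV.nil q hQ hF hP
  · intro q hq hqF hqP a x
    obtain ⟨hQ, hF, hP⟩ := key hq hqF hqP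
    have hq₂ : q ∉ B₂.Q := Finset.disjoint_left.1 hd hq
    rw [hV.cons q hQ hF hP]
    simp [alt, BForm.eval, h₂.dead q (.inl hq₂)]

theorem Models.alt_right (hV : Models V (alt B₁ B₂) c) (h₁ : Sane R B₁)
    (hd : Disjoint B₁.Q B₂.Q) : Models V B₂ c := by
  have key {q : BVar M} (hq : q ∈ B₂.Q) (hqF : q ∉ B₂.F) (hqP : q ∉ B₂.P) :
      q ∈ (alt B₁ B₂).Q ∧ q ∉ (alt B₁ B₂).F ∧ q ∉ (alt B₁ B₂).P := by
    have hq₁ : q ∉ B₁.Q := Finset.disjoint_right.1 hd hq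
    exact ⟨Finset.mem_union_right _ hq,
      fun h => (Finset.mem_union.1 h).elim (fun h => hq₁ (h₁.F_subset h)) hqF,
      fun h => (Finset.mem_union.1 h).elim (fun h => hq₁ (h₁.P_subset h)) hqP⟩
  constructor
  · exact fun x q hq => hV.F x q (Finset.mem_union_right _ hq)
  · exact fun x q hq => hV.P x q (Finset.mem_union_right _ hq)
  · intro q hq hqF hqP
    obtain ⟨hQ, hF, hP⟩ := key hq hqF hqP
    exact hV.nil q hQ hF hP
  · intro q hq hqF hqP a x
    obtain ⟨hQ, hF, hP⟩ := key hq hqF hqP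
    have hq₁ : q ∉ B₁.Q := Finset.disjoint_right.1 hd hq
    rw [hV.cons q hQ hF hP]
    simp [alt, BForm.eval, h₁.dead q (.inl hq₁)]

theorem Local.alt_left {U V : BVar M → Bool} {b : Bool} (hU : Local U b V (alt B₁ B₂))
    (h₂ : Sane R B₂) (hd : Disjoint B₁.Q B₂.Q) : Local U b V B₁ where
  F q hq := hU.F q (Finset.mem_union_left _ hq)
  Q q hq hqF := hU.Q q (Finset.mem_union_left _ hq) fun h => (Finset.mem_union.1 h).elim hqF
    fun h => Finset.disjoint_left.1 hd hq (h₂.F_subset h)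

theorem Local.alt_right {U V : BVar M → Bool} {b : Bool} (hU : Local U b V (alt B₁ B₂))
    (h₁ : Sane R B₁) (hd : Disjoint B₁.Q B₂.Q) : Local U b V B₂ where
  F q hq := hU.F q (Finset.mem_union_right _ hq)
  Q q hq hqF := hU.Q q (Finset.mem_union_right _ hq) fun h => (Finset.mem_union.1 h).elim
    (fun h => Finset.disjoint_right.1 hd hq (h₁.F_subset h)) hqF

theorem Correct.alt {e₁ e₂ : AExp σ M} (he₁ : Correct rule e₁ B₁) (he₂ : Correct rule e₂ B₂)
    (h₁ : Sane R B₁) (h₂ : Sane R B₂) (hd : Disjoint B₁.Q B₂.Q) :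
    Correct rule (.alt e₁ e₂) (alt B₁ B₂) := by
  intro V c hV S x r hr U b hU
  have hV₁ := hV.alt_left h₂ hd
  have hV₂ := hV.alt_right h₁ hd
  have hU₁ := hU.alt_left h₂ hd
  have hU₂ := hU.alt_right h₁ hd
  cases hr with
  | alt_left hr₁ hr₂ =>
    simp [PreBFA.alt, BForm.eval, he₁ V c hV₁ _ _ _ hr₁ U b hU₁, he₂ V c hV₂ _ _ _ hr₂ U b hU₂,
      outcome]
  | alt_right hr₁ hr₂ =>
    simp [PreBFA.alt, BForm.eval, he₁ V c hV₁ _ _ _ hr₁ U b hU₁, he₂ V c hV₂ _ _ _ hr₂ U b hU₂,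
      outcome]

/-! ### Not-predicates -/

/-- The states of `B` that were final become true forever in `not s B`. -/
theorem Models.of_not {s : ℕ} (hV : Models V (not s B) c) (hs : .state s ∉ B.Q) :
    Models V B (fun _ => true) := by
  have key {q : BVar M} (hq : q ∈ B.Q) (hqF : q ∉ B.F) (hqP : q ∉ B.P) :
      q ∈ (not s B).Q ∧ q ∉ (not s B).F ∧ q ∉ (not s B).P := by
    refine ⟨Finset.mem_union_left _ hq, fun h => ?_, fun h => (Finset.mem_union.1 h).elim hqF hqP⟩
    exact hs (Finset.mem_singleton.1 h ▸ hq)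
  constructor
  · exact fun x q hq => hV.P x q (Finset.mem_union_left _ hq)
  · exact fun x q hq => hV.P x q (Finset.mem_union_right _ hq)
  · intro q hq hqF hqP
    obtain ⟨hQ, hF, hP⟩ := key hq hqF hqP
    exact hV.nil q hQ hF hP
  · intro q hq hqF hqP a x
    obtain ⟨hQ, hF, hP⟩ := key hq hqF hqP
    rw [hV.cons q hQ hF hP]
    simp [not, BForm.eval, hqF, hqP]

theorem Correct.not {e : AExp σ M} (he : Correct rule e B) (h : Sane R B) {s : ℕ}
    (hs : .state s ∉ B.Q) : Correct rule (.not e) (not s B) := by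
  intro V c hV S x r hr U b hU
  have hV' := hV.of_not hs
  have hsU : U (.state s) = b := hU.F _ (Finset.mem_singleton_self _)
  have hU' : Local U true (V x) B := by
    have hQ : ∀ q ∈ B.Q, U q = V x q := fun q hq =>
      hU.Q q (Finset.mem_union_left _ hq) fun hqF => hs (Finset.mem_singleton.1 hqF ▸ hq)
    exact ⟨fun q hq => (hQ q (h.F_subset hq)).trans (hV'.F x q hq), fun q hq _ => hQ q hq⟩
  have heval {r : Option (List σ)} (hr : AExp.Eval rule S e x r) :
      (PreBFA.not s B).f₀.eval U = (b && !r.isSome) := by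
    simp [PreBFA.not, BForm.eval, hsU, he V _ hV' S x r hr U true hU', outcome_true]
  cases hr with
  | not hr => simp [heval hr, outcome]
  | not_fail hr => simp [heval hr, outcome]

/-- The continuation of a not-predicate does not affect the automaton inside it. -/
theorem eval_phi_of_fresh {f : BForm (BVar M)} (hf : f.vars ⊆ ↑B.Q ∪ R) {s : ℕ}
    (hs : .state s ∉ B.Q) (hsR : .state s ∉ R) (g : BForm (BVar M)) (U : BVar M → Bool) :
    (f.phi g {.state s}).eval U = f.eval U := by
  rw [eval_phi]
  refine BForm.eval_congr fun v hv => continued_of_notMem (fun h => ?_) g U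
  rw [Finset.mem_singleton.1 h] at hv
  exact (hf hv).elim hs hsR

theorem eval_notSeq (h₁ : Sane R B₁) {s : ℕ} (hs : .state s ∉ B₁.Q) (hsR : .state s ∉ R)
    {U : BVar M → Bool} (hU : U (.state s) = false) :
    (seq (not s B₁) B₂).f₀.eval U = (B₂.f₀.eval U && !B₁.f₀.eval U) := by
  have h := eval_phi_of_fresh h₁.vars_f₀ hs hsR B₂.f₀ U
  rw [eval_phi] at h
  change ((PreBFA.not s B₁).f₀.phi B₂.f₀ {.state s}).eval U = _
  rw [eval_phi]
  simp only [not, BForm.eval, h]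
  simp [continued, hU]

/-- In `!e₁ e₂` the automaton of `e₁` is unaffected by `e₂`. -/
theorem Models.notSeq_left {s : ℕ} (hV : Models V (seq (not s B₁) B₂) c) (h₁ : Sane R B₁)
    (h₂ : Sane R B₂) (hs : .state s ∉ B₁.Q) (hsR : .state s ∉ R)
    (hd : Disjoint (not s B₁).Q B₂.Q) : Models V B₁ (fun _ => true) := by
  have h := (hV.seq_left (h₁.not hs) h₂ hd).of_not hs
  have hne {q : BVar M} (hq : q ∈ B₁.Q) : q ∉ (not s B₁).F :=
    fun hqF => hs (Finset.mem_singleton.1 hqF ▸ hq)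
  constructor
  · intro x q hq
    have := h.F x q hq
    rwa [continued_of_notMem (hne (h₁.F_subset hq))] at this
  · intro x q hq
    have := h.P x q hq
    rwa [continued_of_notMem (hne (h₁.P_subset hq))] at this
  · intro q hq hqF hqP
    have := h.nil q hq hqF hqP
    rwa [continued_of_notMem (hne hq)] at this
  · intro q hq hqF hqP a x
    have := h.cons q hq hqF hqP a x
    rw [continued_of_notMem (hne hq), ← eval_phi] at this
    rw [this]
    exact eval_phi_of_fresh (h₁.vars_δ q a) hs hsR _ _

/-! ### Repetitions -/

section Star

variable {r r' s₁ s₂ s₃ s₄ : ℕ} {B₃ B₄ : PreBFA σ M} {p : AExp σ M}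

/-- `p R' | !(p R') ε`, inside a not-predicate, is true whatever the value of `R'` is. -/
theorem eval_starX (hd : StarDisjoint r r' s₁ s₂ s₃ s₄ B₁ B₂ B₃ B₄) (hp₃ : Correct rule p B₃)
    (hp₄ : Correct rule p B₄) (h₃ : Sane R B₃) (h₄ : Sane R B₄) (hr' : .state r' ∈ R)
    (hs₃ : .state s₃ ∉ R) (hV : Models V (starX r' s₃ s₄ B₃ B₄) fun _ => true) {S : Finset M}
    {x : List σ} {o : Option (List σ)} (ho : AExp.Eval rule S p x o) {U : BVar M → Bool}
    (hU : ∀ q ∈ (starX r' s₃ s₄ B₃ B₄).Q, U q = V x q) :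
    (starX r' s₃ s₄ B₃ B₄).f₀.eval U = true := by
  obtain ⟨⟨hc₁, hc₂, hc₃⟩, -⟩ := hd.conditions
  have hv : Sane R (ofVar (.state r') : PreBFA σ M) := .ofVar hr'
  have hL := h₃.seq hv (Finset.disjoint_empty_right _)
  have hZ := h₄.seq hv (Finset.disjoint_empty_right _)
  have hN := hZ.not hc₁
  have hR := hN.seq (.eps R s₄) hc₂
  have hVL := hV.alt_left hR hc₃
  have hVR := hV.alt_right hL hc₃
  have hVZ := hVR.notSeq_left hZ (.eps R s₄) hc₁ hs₃ hc₂
  have hLe := hp₃.eval_seq h₃ hv (Finset.disjoint_empty_right _) hVL ho (U := U)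
    fun q hq => hU q (by simp [starX, alt, seq, hq])
  have hZe := hp₄.eval_seq h₄ hv (Finset.disjoint_empty_right _) hVZ ho (U := U)
    fun q hq => hU q (by simp [starX, alt, seq, not, hq])
  have hU₃ : U (.state s₃) = false :=
    (hU _ (by simp [starX, alt, seq, not])).trans
      (hVR.seq_dead hN (.eps R s₄) hc₂ (Finset.mem_singleton_self _) x)
  have hU₄ : U (.state s₄) = true :=
    (hU _ (by simp [starX, alt, seq, eps])).trans (hVR.F x _ (Finset.mem_singleton_self _))
  have hRe := eval_notSeq (B₂ := eps s₄) hZ hc₁ hs₃ hU₃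
  simp only [starX, PreBFA.alt, BForm.eval]
  rw [hRe, hLe, hZe]
  simp [eps, BForm.eval, hU₄]

/-- The value of `p R | !(p R') ε` in terms of the values of `R` and of the right-hand side of `R'`.
The latter is in a not-predicate, so that its final states are true. -/
theorem eval_starY (hd : StarDisjoint r r' s₁ s₂ s₃ s₄ B₁ B₂ B₃ B₄) (hp₁ : Correct rule p B₁)
    (hp₂ : Correct rule p B₂) (h₁ : Sane R B₁) (h₂ : Sane R B₂) (h₃ : Sane R B₃) (h₄ : Sane R B₄)
    (hr : .state r ∈ R) (hr' : .state r' ∈ R) (hs₁ : .state s₁ ∉ R)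
    (hV : Models V (starY r s₁ s₂ (starX r' s₃ s₄ B₃ B₄) B₁ B₂) c) :
    Models V (starX r' s₃ s₄ B₃ B₄) (fun _ => true) ∧
    ∀ {S : Finset M} {x : List σ} {o : Option (List σ)}, AExp.Eval rule S p x o →
      ∀ {U : BVar M → Bool} {b : Bool},
      Local U b (V x) (starY r s₁ s₂ (starX r' s₃ s₄ B₃ B₄) B₁ B₂) →
      (starY r s₁ s₂ (starX r' s₃ s₄ B₃ B₄) B₁ B₂).f₀.eval U =
        (outcome (U (.state r)) (fun w => V w (.state r)) x o ||
          (b && !outcome ((starX r' s₃ s₄ B₃ B₄).f₀.eval U)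
            (fun w => (starX r' s₃ s₄ B₃ B₄).f₀.eval (V w)) x o)) := by
  obtain ⟨-, hc₀, ⟨hc₁, hc₂, hc₃⟩, -, -⟩ := hd.conditions
  have hv : Sane R (ofVar (.state r) : PreBFA σ M) := .ofVar hr
  have hX : Sane R (starX r' s₃ s₄ B₃ B₄) := .starX hd h₃ h₄ hr'
  have hL := h₁.seq hv (Finset.disjoint_empty_right _)
  have hZ := h₂.seq hX hc₀
  have hN := hZ.not hc₁
  have hR := hN.seq (.eps R s₂) hc₂
  have hVL := hV.alt_left hR hc₃
  have hVR := hV.alt_right hL hc₃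
  have hVZ := hVR.notSeq_left hZ (.eps R s₂) hc₁ hs₁ hc₂
  refine ⟨hVZ.seq_right h₂ hc₀, fun {S x o} ho {U b} hU => ?_⟩
  have hUL := hU.alt_left hR hc₃
  have hUR := hU.alt_right hL hc₃
  have hUN := hUR.seq_left (.eps R s₂) hc₂
  have hLe := hp₁.eval_seq h₁ hv (Finset.disjoint_empty_right _) hVL ho
    (hUL.seq_left hv (Finset.disjoint_empty_right _))
  have hZe := hp₂.eval_seq h₂ hX hc₀ hVZ ho (U := U)
    fun q hq => hUN q (by simp [seq, not, hq])
  have hU₁ : U (.state s₁) = false :=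
    (hUN _ (by simp [not])).trans
      (hVR.seq_dead hN (.eps R s₂) hc₂ (Finset.mem_singleton_self _) x)
  have hU₂ : U (.state s₂) = b := hUR.F _ (Finset.mem_singleton_self _)
  have hRe := eval_notSeq (B₂ := eps s₂) hZ hc₁ hs₁ hU₁
  rw [starY]
  simp only [PreBFA.alt, BForm.eval]
  rw [hRe, hLe, hZe]
  simp [eps, ofVar, BForm.eval, hU₂]

/-- Each round of `p*` consumes something, so two rounds of replacement of `r` and `r'` suffice. -/
theorem Correct.star (hd : StarDisjoint r r' s₁ s₂ s₃ s₄ B₁ B₂ B₃ B₄) (hp₁ : Correct rule p B₁)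
    (hp₂ : Correct rule p B₂) (hp₃ : Correct rule p B₃) (hp₄ : Correct rule p B₄)
    (h₁ : Sane R B₁) (h₂ : Sane R B₂) (h₃ : Sane R B₃) (h₄ : Sane R B₄)
    (hR : ∀ n, .state n ∉ R) :
    Correct rule (.star p) (star r r' s₁ s₂ s₃ s₄ B₁ B₂ B₃ B₄) := by
  intro V c hV S x o ho U b hU
  rw [star_eq] at hV hU ⊢
  set X := starX r' s₃ s₄ B₃ B₄ with hX
  set Y := starY r s₁ s₂ X B₁ B₂ with hY
  set tbl := starTbl r r' X Y with htbl
  obtain ⟨-, -, -, hrY, hrY'⟩ := hd.conditions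
  have hvar {q : BVar M} (hq : q ∈ Y.Q) (k : ℕ) : BForm.unroll tbl k q = .var q := by
    refine BForm.unroll_of_none ?_ k
    have h₁ : q ≠ .state r := fun h => hrY (h ▸ hq)
    have h₂ : q ≠ .state r' := fun h => hrY' (h ▸ hq)
    simp [htbl, starTbl, h₁, h₂]
  -- `W k` evaluates variables after `k` rounds of replacement of `r` and `r'`.
  set W : ℕ → (BVar M → Bool) → BVar M → Bool := fun k U v => (BForm.unroll tbl k v).eval U with hW
  have hWr (U : BVar M → Bool) : W 2 U (.state r) = Y.f₀.eval (W 1 U) := by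
    simp only [hW]
    rw [BForm.unroll_succ_of_some (g := Y.f₀) (by simp [htbl, starTbl]), BForm.eval_subst]
  have hWQ {q : BVar M} (hq : q ∈ Y.Q) (k : ℕ) (U : BVar M → Bool) : W k U q = U q := by
    simp only [hW, hvar hq k, BForm.eval]
  set R' : Set (BVar M) := R ∪ {.state r, .state r'} with hR'
  have hsub : R ⊆ R' := Set.subset_union_left
  have hr : BVar.state r ∈ R' := by simp [hR']
  have hr' : BVar.state r' ∈ R' := by simp [hR']
  have hn := hd.nodup
  have hs₁ : BVar.state s₁ ∉ R' := by
    simp [hR', hR] at hn ⊢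
    grind
  have hs₃ : BVar.state s₃ ∉ R' := by
    simp [hR', hR] at hn ⊢
    grind
  have hYs : Sane R' Y :=
    .starY hd (h₁.mono hsub) (h₂.mono hsub) (h₃.mono hsub) (h₄.mono hsub) hr hr'
  have hVY : Models (fun x => W 2 (V x)) Y c := by
    constructor
    · exact fun x q hq => (hWQ (hYs.F_subset hq) 2 _).trans (hV.F x q hq)
    · exact fun x q hq => (hWQ (hYs.P_subset hq) 2 _).trans (hV.P x q hq)
    · exact fun q hq hqF hqP => (hWQ hq 2 _).trans (hV.nil q hq hqF hqP)
    · exact fun q hq hqF hqP a x =>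
        (hWQ hq 2 _).trans ((hV.cons q hq hqF hqP a x).trans (BForm.eval_subst _ _ _))
  obtain ⟨hVX, hYe⟩ := eval_starY hd hp₁ hp₂ (h₁.mono hsub) (h₂.mono hsub) (h₃.mono hsub)
    (h₄.mono hsub) hr hr' hs₁ hVY
  replace hYe : ∀ {S : Finset M} {x : List σ} {o : Option (List σ)}, AExp.Eval rule S p x o →
      ∀ {U : BVar M → Bool} {b : Bool}, Local U b (W 2 (V x)) Y →
      Y.f₀.eval U = (outcome (U (.state r)) (fun w => W 2 (V w) (.state r)) x o ||
        (b && !outcome (X.f₀.eval U) (fun w => X.f₀.eval (W 2 (V w))) x o)) := hYe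
  have key : ∀ (n : ℕ) (S : Finset M) (x : List σ) (o : Option (List σ)), x.length = n →
      AExp.Eval rule S (.star p) x o → ∀ U b, Local U b (W 2 (V x)) Y →
      Y.f₀.eval U = outcome b c x o := by
    intro n
    induction n using Nat.strong_induction_on with
    | _ n ih =>
      intro S x o hx ho U b hU
      cases ho with
      | star_nil hp => simp [hYe hp hU, outcome]
      | @star_step _ _ _ y w z hxy hy hp hps =>
        subst hxy
        have hlen : w.length < n := by
          have := List.length_pos_of_ne_nil hy
          simp at hx
          omega
        -- `p` succeeds, hence so does `p R'`, and the value is that of `r` on the remaining input.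
        have hXw : X.f₀.eval (W 2 (V w)) = true := by
          obtain ⟨o', ho'⟩ : ∃ o', AExp.Eval rule ∅ p w o' := by
            cases hps with
            | star_nil h => exact ⟨_, h⟩
            | star_step _ _ h _ => exact ⟨_, h⟩
          exact eval_starX hd hp₃ hp₄ (h₃.mono hsub) (h₄.mono hsub) hr' hs₃ hVX ho' fun q _ => rfl
        have hYw := ih w.length hlen ∅ w (some z) rfl hps (W 1 (V w)) (c w)
          ⟨fun q hq => (hWQ (hYs.F_subset hq) 1 _).trans (hV.F w q hq),
            fun q hq _ => (hWQ hq 1 _).trans (hWQ hq 2 _).symm⟩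
        rw [hYe hp hU, show some (y ++ z) = (some z).map (y ++ ·) from rfl, outcome_append b c hy,
          ← hYw, ← hWr]
        simp only [outcome, if_neg hy, List.drop_left, hXw]
        simp
  refine (BForm.eval_subst _ _ _).trans (key x.length S x o rfl ho (W 2 U) b ⟨?_, ?_⟩)
  · exact fun q hq => (hWQ (hYs.F_subset hq) 2 _).trans (hU.F q hq)
  · exact fun q hq hqF => (hWQ hq 2 _).trans ((hU.Q q hq hqF).trans (hWQ hq 2 _).symm)

end Star

end PreBFA

/-! ### Automata of nonterminal-free expressions -/

namespace AExp

open PreBFA (Correct)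

variable {σ M : Type*} [DecidableEq M] {rule : M → AExp σ M}

theorem correct_empty (s : ℕ) : Correct rule .empty (.eps s) := by
  intro V c hV S x r hr U b hU
  cases hr
  exact hU.F _ (Finset.mem_singleton_self _)

variable [DecidableEq σ]

theorem correct_char (a : σ) {s t : ℕ} (hst : s ≠ t) :
    Correct rule (.char a) (.char a s t) := by
  intro V c hV S x r hr U b hU
  have hsQ : BVar.state s ∈ (PreBFA.char a s t : PreBFA σ M).Q := by simp [PreBFA.char]
  have hsF : BVar.state s ∉ (PreBFA.char a s t : PreBFA σ M).F := by simp [PreBFA.char, hst]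
  have hsP : BVar.state s ∉ (PreBFA.char a s t : PreBFA σ M).P := by simp [PreBFA.char]
  refine (hU.Q _ hsQ hsF).trans ?_
  cases hr with
  | char _ x =>
    rw [hV.cons _ hsQ hsF hsP]
    simpa [PreBFA.char, BForm.eval, outcome] using hV.F x (.state t) (Finset.mem_singleton_self _)
  | char_ne x h =>
    rw [hV.cons _ hsQ hsF hsP]
    simp [PreBFA.char, BForm.eval, outcome, h.symm]
  | char_nil => exact hV.nil _ hsQ hsF hsP

theorem NFree.correct_conv {p : AExp σ M} (hp : p.NFree)
    {call : M → TState M → PreBFA σ M × TState M} (hcall : ∀ A S, Built S (call A S))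
    (S : TState M) : Correct rule p (conv call p S).1 := by
  induction p generalizing S with
  | empty => exact correct_empty _
  | char a => exact correct_char a (Nat.succ_ne_self _).symm
  | nt A => exact hp.elim
  | seq e₁ e₂ ih₁ ih₂ =>
    have h₁ := built_conv hcall e₁ S
    have h₂ := built_conv hcall e₂ (conv call e₁ S).2
    exact (ih₁ hp.1 S).seq (ih₂ hp.2 _) h₁.sane h₂.sane (h₁.inRange.disjoint h₂.inRange le_rfl)
  | alt e₁ e₂ ih₁ ih₂ =>
    have h₁ := built_conv hcall e₁ S
    have h₂ := built_conv hcall e₂ (conv call e₁ S).2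
    exact (ih₁ hp.1 S).alt (ih₂ hp.2 _) h₁.sane h₂.sane (h₁.inRange.disjoint h₂.inRange le_rfl)
  | star e ih =>
    exact .star (starDisjoint_conv hcall e S) (ih hp _) (ih hp _) (ih hp _) (ih hp _)
      (built_conv hcall e _).sane (built_conv hcall e _).sane (built_conv hcall e _).sane
      (built_conv hcall e _).sane (by simp)
  | not e ih =>
    have h := built_conv hcall e { S with next := S.next + 1 }
    exact (ih hp _).not h.sane (h.inRange.notMem (.inl (Nat.lt_succ_self _)))

end AExp

/-! ### Linear expressions -/

namespace AExp

variable {σ M : Type*} [DecidableEq M]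

/-- `Computes rule K t D e F`: the value `F k x` of `e` on the input `x` is put together from the
values of its parts in the way of a linear expression, where `k` is the number of rounds of
replacement of temporary variables that are left at the current position, and `K` is the number of
rounds that are available again after some input is consumed. The values of the temporary variables
are given by `t`; only nonterminals in `D` may be represented by them. -/
inductive Computes (rule : M → AExp σ M) (K : ℕ) (t : ℕ → List σ → M → Bool) (D : M → Prop) :
    AExp σ M → (ℕ → List σ → Bool) → Prop
  | nfree {p : AExp σ M} {F : ℕ → List σ → Bool} :
      (∀ S x r, Eval rule S p x r → ∀ k, F k x = r.isSome) → Computes rule K t D p F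
  | tmp {A : M} : D A → Computes rule K t D (nt A) fun k x => t k x A
  | nt {A : M} {F : ℕ → List σ → Bool} :
      Computes rule K t D (rule A) F → Computes rule K t D (nt A) F
  | seq {p e : AExp σ M} {F G : ℕ → List σ → Bool} :
      (∀ S x r, Eval rule S p x r → ∀ k, F k x = outcome (G k x) (G K) x r) →
      Computes rule K t D e G → Computes rule K t D (seq p e) F
  | not {e : AExp σ M} {F : ℕ → List σ → Bool} :
      Computes rule K t D e F → Computes rule K t D (not e) fun k x => !F k x
  | notSeq {e₁ e₂ : AExp σ M} {F G₁ G₂ : ℕ → List σ → Bool} :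
      (∀ k x, F k x = (G₂ k x && !G₁ k x)) → Computes rule K t D e₁ G₁ →
      Computes rule K t D e₂ G₂ → Computes rule K t D (seq (not e₁) e₂) F
  | alt {e₁ e₂ : AExp σ M} {F G₁ G₂ : ℕ → List σ → Bool} :
      (∀ k x, F k x = (G₁ k x || G₂ k x)) → Computes rule K t D e₁ G₁ →
      Computes rule K t D e₂ G₂ → Computes rule K t D (alt e₁ e₂) F

/-- The values are right if one more round of replacement turns a temporary variable into the value
of the right-hand side of its nonterminal. The rounds suffice, because the nonterminals that are
applied at the same position, one inside the evaluation of the other, are distinct. -/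
theorem Computes.eq_isSome [Fintype M] {rule : M → AExp σ M} {K : ℕ}
    {t : ℕ → List σ → M → Bool} {D : M → Prop} (hK : Fintype.card M ≤ K)
    (hD : ∀ A, D A → ∃ F, Computes rule K t D (rule A) F ∧ ∀ k x, t (k + 1) x A = F k x)
    {S : Finset M} {e : AExp σ M} {x : List σ} {r : Option (List σ)} (hr : Eval rule S e x r)
    {F : ℕ → List σ → Bool} (hF : Computes rule K t D e F) {k : ℕ}
    (hk : Fintype.card M ≤ S.card + k) : F k x = r.isSome := by
  induction hr generalizing F k with
  | empty x => cases hF with | nfree h => exact h ∅ _ _ (.empty x) k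
  | char a x => cases hF with | nfree h => exact h ∅ _ _ (.char a x) k
  | char_ne x hab => cases hF with | nfree h => exact h ∅ _ _ (.char_ne x hab) k
  | char_nil a => cases hF with | nfree h => exact h ∅ _ _ (.char_nil a) k
  | @nt S A x r hA hr ih =>
    have hcard := Finset.card_insert_of_notMem hA
    cases hF with
    | nfree h => exact h _ _ _ (.nt hA hr) k
    | tmp hDA =>
      obtain ⟨F, hF, ht⟩ := hD A hDA
      have hle := Finset.card_le_univ (insert A S)
      obtain ⟨k, rfl⟩ : ∃ k', k = k' + 1 := ⟨k - 1, by omega⟩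
      exact (ht k x).trans (ih hF (by omega))
    | nt hF => exact ih hF (by omega)
  | @seq S S' e₁ e₂ x y w r r' hx hr' hS hr₁ hr₂ ih₁ ih₂ =>
    cases hF with
    | nfree h => exact h _ _ _ (.seq hx hr' hS hr₁ hr₂) k
    | seq h hG =>
      subst hr'
      rw [h _ _ _ hr₁ k, outcome, Option.isSome_map]
      split_ifs with hy
      · subst hy
        obtain rfl : x = w := hx
        exact ih₂ hG (hk.trans (Nat.add_le_add_right (Finset.card_le_card (hS rfl)) k))
      · subst hx
        rw [List.drop_left]
        exact ih₂ hG (hK.trans (Nat.le_add_left _ _))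
    | notSeq h hG₁ hG₂ =>
      subst hr'
      have h₁ := ih₁ hG₁.not hk
      obtain rfl : y = [] := by cases hr₁; rfl
      obtain rfl : x = w := hx
      have h₂ := ih₂ hG₂ (hk.trans (Nat.add_le_add_right (Finset.card_le_card (hS rfl)) k))
      rw [h, h₁, h₂, Option.isSome_map]
      simp
  | seq_fail hr₁ ih₁ =>
    cases hF with
    | nfree h => exact h _ _ _ (.seq_fail hr₁) k
    | seq h hG => exact h _ _ _ hr₁ k
    | notSeq h hG₁ hG₂ =>
      rw [h, ih₁ hG₁.not hk]
      simp
  | alt_left hr₁ hr₂ ih₁ ih₂ =>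
    cases hF with
    | nfree h => exact h _ _ _ (.alt_left hr₁ hr₂) k
    | alt h hG₁ hG₂ =>
      rw [h, ih₁ hG₁ hk, ih₂ hG₂ hk]
      rfl
  | alt_right hr₁ hr₂ ih₁ ih₂ =>
    cases hF with
    | nfree h => exact h _ _ _ (.alt_right hr₁ hr₂) k
    | alt h hG₁ hG₂ =>
      rw [h, ih₁ hG₁ hk, ih₂ hG₂ hk]
      rfl
  | star_nil hr => cases hF with | nfree h => exact h _ _ _ (.star_nil hr) k
  | star_step hx hy hr₁ hr₂ => cases hF with | nfree h => exact h _ _ _ (.star_step hx hy hr₁ hr₂) k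
  | not hr ih =>
    cases hF with
    | nfree h => exact h _ _ _ (.not hr) k
    | not hF => simp [ih hF hk]
  | not_fail hr ih =>
    cases hF with
    | nfree h => exact h _ _ _ (.not_fail hr) k
    | not hF => simp [ih hF hk]

end AExp

namespace PreBFA

variable {σ M : Type*}

/-- `V` gives the values of the states and of the temporary variables, the latter after a number of
rounds of replacement, for an automaton `B` that is in tail position: whatever follows `B` is
true. -/
structure TailModels (K : ℕ) (V : ℕ → List σ → BVar M → Bool) (B : PreBFA σ M) : Prop where
  models : Models (V K) B fun _ => true
  inits : ∀ i ∈ B.inits, ∀ k x, V (k + 1) x (.tmp i.1) = i.2.eval (V k x)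

variable [DecidableEq M] {K : ℕ} {V : ℕ → List σ → BVar M → Bool} {B B₁ B₂ : PreBFA σ M}
  {R : Set (BVar M)}

theorem TailModels.alt_left (h : TailModels K V (alt B₁ B₂)) (h₂ : Sane R B₂)
    (hd : Disjoint B₁.Q B₂.Q) : TailModels K V B₁ :=
  ⟨h.models.alt_left h₂ hd, fun i hi => h.inits i (List.mem_append_left _ hi)⟩

theorem TailModels.alt_right (h : TailModels K V (alt B₁ B₂)) (h₁ : Sane R B₁)
    (hd : Disjoint B₁.Q B₂.Q) : TailModels K V B₂ :=
  ⟨h.models.alt_right h₁ hd, fun i hi => h.inits i (List.mem_append_right _ hi)⟩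

theorem TailModels.seq_right (h : TailModels K V (seq B₁ B₂)) (h₁ : Sane R B₁)
    (hd : Disjoint B₁.Q B₂.Q) : TailModels K V B₂ :=
  ⟨h.models.seq_right h₁ hd, fun i hi => h.inits i (List.mem_append_right _ hi)⟩

theorem TailModels.notSeq_left {s : ℕ} (h : TailModels K V (seq (not s B₁) B₂)) (h₁ : Sane R B₁)
    (h₂ : Sane R B₂) (hs : .state s ∉ B₁.Q) (hsR : .state s ∉ R)
    (hd : Disjoint (not s B₁).Q B₂.Q) : TailModels K V B₁ := by
  refine ⟨h.models.notSeq_left h₁ h₂ hs hsR hd, fun i hi k x => ?_⟩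
  have := h.inits (i.1, i.2.phi B₂.f₀ {.state s})
    (List.mem_append_left _ (List.mem_map_of_mem (f := fun i : M × BForm (BVar M) =>
      (i.1, i.2.phi B₂.f₀ {.state s})) hi)) k x
  rw [this]
  exact eval_phi_of_fresh (h₁.vars_inits i hi) hs hsR _ _

end PreBFA

namespace AExp

open PreBFA (TailModels)

variable {σ M : Type*} [DecidableEq σ] [DecidableEq M]

/-- For a conversion of `e` that starts in `S` with the result `res`: the initial function computes
the value of `e`, and the temporary variables of the nonterminals that are expanded stand for
functions that compute the values of their right-hand sides. -/
def Sound (rule : M → AExp σ M) (K : ℕ) (V : ℕ → List σ → BVar M → Bool) (D : M → Prop)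
    (e : AExp σ M) (S : TState M) (res : PreBFA σ M × TState M) : Prop :=
  Computes rule K (fun k x A => V k x (.tmp A)) D e (fun k x => res.1.f₀.eval (V k x)) ∧
    ∀ A ∈ res.2.applied, A ∉ S.applied →
      ∃ F, Computes rule K (fun k x A => V k x (.tmp A)) D (rule A) F ∧
        ∀ k x, V (k + 1) x (.tmp A) = F k x

variable [Fintype M] {rule : M → AExp σ M} {K : ℕ} {V : ℕ → List σ → BVar M → Bool} {D : M → Prop}

/-- The bound `hj` on the fuel `j` ensures that every nonterminal that is met is expanded, here or
earlier. -/
theorem IsLinear.sound_conv (hV : ∀ k x n, V k x (.state n) = V K x (.state n))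
    {call : M → TState M → PreBFA σ M × TState M} (hcall : ∀ A S, Built S (call A S)) {j : ℕ}
    (hsound : ∀ A S, Fintype.card M ≤ j + S.applied.toFinset.card →
      (∀ B ∈ (call A S).2.applied, D B) → TailModels K V (call A S).1 →
      Sound rule K V D (.nt A) S (call A S))
    {e : AExp σ M} (he : e.IsLinear) (S : TState M)
    (hj : Fintype.card M ≤ j + S.applied.toFinset.card)
    (hD : ∀ B ∈ (conv call e S).2.applied, D B) (hm : TailModels K V (conv call e S).1) :
    Sound rule K V D e S (conv call e S) := by
  have hQ {S : TState M} {res : PreBFA σ M × TState M} (h : Built S res) (k : ℕ) (x : List σ) :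
      ∀ q ∈ res.1.Q, V k x q = V K x q := by
    intro q hq
    obtain ⟨n, rfl, -⟩ := h.inRange q hq
    exact hV k x n
  have hgrow {S : TState M} {res : PreBFA σ M × TState M} (h : Built S res)
      (hj : Fintype.card M ≤ j + S.applied.toFinset.card) :
      Fintype.card M ≤ j + res.2.applied.toFinset.card :=
    hj.trans (Nat.add_le_add_left (Finset.card_le_card fun A hA =>
      List.mem_toFinset.2 (h.expanded.subset (List.mem_toFinset.1 hA))) j)
  induction he generalizing S with
  | @nfree p hp =>
    have hb := built_conv hcall p S
    refine ⟨.nfree fun T x r hr k => ?_, fun A hA hAS => ?_⟩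
    · rw [hp.correct_conv hcall S _ _ hm.models T x r hr (V k x) true
        ⟨fun q hq => ?_, fun q hq _ => hQ hb k x q hq⟩, outcome_true]
      exact (hQ hb k x q (hb.sane.F_subset hq)).trans (hm.models.F x q hq)
    · rw [hp.applied_conv] at hA
      exact absurd hA hAS
  | nt A => exact hsound A S hj hD hm
  | @seq p e hp _ ih =>
    have h₁ := built_conv hcall p S
    have h₂ := built_conv hcall e (conv call p S).2
    have hd := h₁.inRange.disjoint h₂.inRange le_rfl
    obtain ⟨hc, ha⟩ := ih (conv call p S).2 (hgrow h₁ hj) hD (hm.seq_right h₁.sane hd)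
    refine ⟨.seq (fun T x r hr k => ?_) hc, ?_⟩
    · exact (hp.correct_conv hcall S).eval_seq h₁.sane h₂.sane hd hm.models hr (hQ h₁ k x)
    · rwa [hp.applied_conv] at ha
  | @alt e₁ e₂ _ _ ih₁ ih₂ =>
    have h₁ := built_conv hcall e₁ S
    have h₂ := built_conv hcall e₂ (conv call e₁ S).2
    have hd := h₁.inRange.disjoint h₂.inRange le_rfl
    obtain ⟨hc₁, ha₁⟩ := ih₁ S hj (fun B hB => hD B (h₂.expanded.subset hB))
      (hm.alt_left h₂.sane hd)
    obtain ⟨hc₂, ha₂⟩ := ih₂ _ (hgrow h₁ hj) hD (hm.alt_right h₁.sane hd)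
    refine ⟨.alt (fun k x => rfl) hc₁ hc₂, fun A hA hAS => ?_⟩
    by_cases hA₁ : A ∈ (conv call e₁ S).2.applied
    exacts [ha₁ A hA₁ hAS, ha₂ A hA hA₁]
  | @notSeq e₁ e₂ _ _ ih₁ ih₂ =>
    have h₀ := built_conv hcall e₁ { S with next := S.next + 1 }
    have h₁ := built_conv hcall (.not e₁) S
    have h₂ := built_conv hcall e₂ (conv call (.not e₁) S).2
    have hd := h₁.inRange.disjoint h₂.inRange le_rfl
    have hs := h₀.inRange.notMem (.inl (Nat.lt_succ_self S.next))
    have hsR : BVar.state S.next ∉ Set.range (BVar.tmp (M := M)) := by simp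
    obtain ⟨hc₁, ha₁⟩ := ih₁ { S with next := S.next + 1 } hj
      (fun B hB => hD B (h₂.expanded.subset hB)) (hm.notSeq_left h₀.sane h₂.sane hs hsR hd)
    obtain ⟨hc₂, ha₂⟩ := ih₂ _ (hgrow h₁ hj) hD (hm.seq_right h₁.sane hd)
    refine ⟨.notSeq (fun k x => ?_) hc₁ hc₂, fun A hA hAS => ?_⟩
    · refine PreBFA.eval_notSeq h₀.sane hs hsR ?_
      rw [hV]
      exact hm.models.seq_dead h₁.sane h₂.sane hd (Finset.mem_singleton_self _) x
    · by_cases hA₁ : A ∈ (conv call (.not e₁) S).2.applied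
      exacts [ha₁ A hA₁ hAS, ha₂ A hA hA₁]

theorem sound_convNT (hV : ∀ k x n, V k x (.state n) = V K x (.state n))
    (hrule : ∀ A, (rule A).IsLinear) (j : ℕ) (A : M) (S : TState M)
    (hj : Fintype.card M ≤ j + S.applied.toFinset.card)
    (hD : ∀ B ∈ (convNT rule j A S).2.applied, D B) (hm : TailModels K V (convNT rule j A S).1) :
    Sound rule K V D (.nt A) S (convNT rule j A S) := by
  have hDA : D A := hD A (mem_applied_convNT rule j A S hj)
  induction j generalizing A S with
  | zero => exact ⟨.tmp hDA, fun B hB hBS => absurd hB hBS⟩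
  | succ j ih =>
    rw [convNT] at hD hm ⊢
    split_ifs at hD hm ⊢ with hA
    · exact ⟨.tmp hDA, fun B hB hBS => absurd hB hBS⟩
    · have hj' : Fintype.card M ≤ j + (A :: S.applied).toFinset.card := by
        rw [List.toFinset_cons, Finset.card_insert_of_notMem (by simpa using hA)]
        omega
      have hm' : TailModels K V
          (conv (convNT rule j) (rule A) { S with applied := A :: S.applied }).1 :=
        ⟨⟨hm.models.F, hm.models.P, hm.models.nil, hm.models.cons⟩,
          fun i hi => hm.inits i (List.mem_cons_of_mem _ hi)⟩
      obtain ⟨hc, ha⟩ := (hrule A).sound_conv hV (built_convNT rule j)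
        (fun B T hT hDT hmT => ih B T hT hDT hmT (hDT B (mem_applied_convNT rule j B T hT)))
        { S with applied := A :: S.applied } hj' hD hm'
      refine ⟨.nt hc, fun B hB hBS => ?_⟩
      by_cases hBA : B = A
      · subst hBA
        exact ⟨_, hc, hm.inits _ List.mem_cons_self⟩
      · exact ha B hB (by simp [hBA, hBS])

end AExp

/-! ### The final automaton -/

namespace BFA

variable {σ V : Type*} [DecidableEq V]

/-- The value of the variable `q` on the input `x`. -/
def value (B : BFA σ V) (x : List σ) (q : V) : Bool :=
  (B.run (.var q) x).eval fun q => decide (q ∈ B.F ∪ B.P)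

theorem eval_run (B : BFA σ V) (f : BForm V) (x : List σ) :
    (B.run f x).eval (fun q => decide (q ∈ B.F ∪ B.P)) = f.eval (B.value x) := by
  induction x generalizing f with
  | nil => rfl
  | cons a x ih =>
    rw [run, ih, BForm.eval_subst]
    congr 1
    funext q
    rw [value, run, BForm.subst, ih]

theorem value_cons (B : BFA σ V) (a : σ) (x : List σ) (q : V) :
    B.value (a :: x) q = (B.δ q a).eval (B.value x) := by
  rw [value, run, eval_run, BForm.subst]

theorem mem_language (B : BFA σ V) (x : List σ) :
    x ∈ B.language ↔ B.f₀.eval (B.value x) = true := by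
  rw [← eval_run]
  rfl

end BFA

theorem List.lookup_eq_some_of_mem_of_nodup {α β : Type*} [DecidableEq α] {l : List (α × β)}
    (hl : (l.map Prod.fst).Nodup) {i : α × β} (hi : i ∈ l) : l.lookup i.1 = some i.2 := by
  induction l with
  | nil => exact absurd hi List.not_mem_nil
  | cons j l ih =>
    rw [List.map_cons, List.nodup_cons] at hl
    rcases List.mem_cons.1 hi with rfl | hi
    · rw [List.lookup_cons, beq_self_eq_true]
    · have hne : i.1 ≠ j.1 := fun h => hl.1 (h ▸ List.mem_map_of_mem hi)
      rw [List.lookup_cons, beq_false_of_ne hne]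
      exact ih hl.2 hi

theorem List.mem_of_lookup_eq_some {α β : Type*} [DecidableEq α] {l : List (α × β)} {a : α} {b : β}
    (h : l.lookup a = some b) : (a, b) ∈ l := by
  obtain ⟨l₁, l₂, rfl, -⟩ := List.lookup_eq_some_iff.1 h
  simp

namespace PreBFA

variable {σ M : Type*} [DecidableEq M] {B : PreBFA σ M}

/-- The table of the temporary variables of `B`. -/
def tmpTbl (B : PreBFA σ M) (v : BVar M) : Option (BForm (BVar M)) :=
  match v with
  | .state _ => none
  | .tmp A => some ((B.inits.lookup A).getD (.const false))

theorem replaceTmp_eq [Fintype M] (B : PreBFA σ M) :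
    B.replaceTmp = (B.substAll (BForm.unroll B.tmpTbl (Fintype.card M))).toBFA :=
  rfl

theorem unroll_tmpTbl_state (B : PreBFA σ M) (k n : ℕ) :
    BForm.unroll B.tmpTbl k (.state n) = .var (.state n) :=
  BForm.unroll_of_none rfl k

theorem sane_substAll_unroll (h : Sane (Set.range BVar.tmp) B) {lo hi : ℕ}
    (hQ : InRange lo hi B.Q) (k : ℕ) : Sane ∅ (B.substAll (BForm.unroll B.tmpTbl k)) := by
  refine h.substAll (fun q hq => ?_) fun v hv => ?_
  · obtain ⟨n, rfl, -⟩ := hQ q hq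
    exact B.unroll_tmpTbl_state k n
  · refine BForm.vars_unroll_subset (W' := ↑B.Q ∪ Set.range BVar.tmp) ?_ ?_ k (.inr hv)
    · rintro v (hv | ⟨A, rfl⟩) htbl
      · exact .inl hv
      · exact absurd htbl (by simp [tmpTbl])
    · intro v g hg
      cases v with
      | state n => exact absurd hg (by simp [tmpTbl])
      | tmp A =>
        obtain rfl := Option.some.inj hg
        cases hA : B.inits.lookup A with
        | none => exact Set.empty_subset _
        | some g => exact h.vars_inits _ (List.mem_of_lookup_eq_some hA)

variable [Fintype M]

/-- After the replacement of the temporary variables, only states occur. -/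
theorem wellFormed_replaceTmp (h : Sane (Set.range BVar.tmp) B) {lo hi : ℕ}
    (hQ : InRange lo hi B.Q) : B.replaceTmp.WellFormed := by
  have hs := sane_substAll_unroll h hQ (Fintype.card M)
  refine ⟨?_, fun q _ a => ?_, hs.F_subset, hs.P_subset⟩
  · simpa [replaceTmp_eq] using hs.vars_f₀
  · simpa [replaceTmp_eq] using hs.vars_δ q a

/-- The value of a variable in the final automaton, where temporary variables are replaced in `k`
rounds. -/
def finalValue (B : PreBFA σ M) (k : ℕ) (x : List σ) (v : BVar M) : Bool :=
  (BForm.unroll B.tmpTbl k v).eval (B.replaceTmp.value x)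

theorem finalValue_state (B : PreBFA σ M) (k : ℕ) (x : List σ) (n : ℕ) :
    B.finalValue k x (.state n) = B.replaceTmp.value x (.state n) := by
  rw [finalValue, unroll_tmpTbl_state, BForm.eval]

theorem finalValue_tmp (hB : (B.inits.map Prod.fst).Nodup) {i : M × BForm (BVar M)}
    (hi : i ∈ B.inits) (k : ℕ) (x : List σ) :
    B.finalValue (k + 1) x (.tmp i.1) = i.2.eval (B.finalValue k x) := by
  rw [finalValue, BForm.unroll_succ_of_some (g := i.2)
    (by simp [tmpTbl, List.lookup_eq_some_of_mem_of_nodup hB hi]), BForm.eval_subst]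
  rfl

theorem mem_language_replaceTmp (B : PreBFA σ M) (x : List σ) :
    x ∈ B.replaceTmp.language ↔ B.f₀.eval (B.finalValue (Fintype.card M) x) = true := by
  rw [BFA.mem_language]
  exact iff_of_eq (congrArg (· = true) (BForm.eval_subst _ _ _))

/-- In the final automaton nothing follows, so that the states in `F` are true at the end of the
input only. -/
theorem models_finalValue (h : Sane (Set.range BVar.tmp) B) {lo hi : ℕ} (hQ : InRange lo hi B.Q) :
    Models (B.finalValue (Fintype.card M)) B List.isEmpty := by
  have hval {q : BVar M} (hq : q ∈ B.Q) (x : List σ) :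
      B.finalValue (Fintype.card M) x q = B.replaceTmp.value x q := by
    obtain ⟨n, rfl, -⟩ := hQ q hq
    exact B.finalValue_state _ x n
  have hnil {q : BVar M} (hq : q ∈ B.Q) :
      B.finalValue (Fintype.card M) [] q = decide (q ∈ B.F ∪ B.P) :=
    hval hq []
  have hcons {q : BVar M} (hq : q ∈ B.Q) (a : σ) (x : List σ) :
      B.finalValue (Fintype.card M) (a :: x) q =
        (B.δ q a).eval (B.finalValue (Fintype.card M) x) := by
    rw [hval hq, BFA.value_cons]
    exact BForm.eval_subst _ _ _
  constructor
  · intro x q hq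
    have hqQ := h.F_subset hq
    cases x with
    | nil => simp [hnil hqQ, hq]
    | cons a x => simp [hcons hqQ, h.dead q (.inr hq)]
  · intro x q hq
    have hqQ := h.P_subset hq
    induction x with
    | nil => simp [hnil hqQ, hq]
    | cons a x ih => rw [hcons hqQ, h.loop q hq a _ ih]
  · intro q hq hqF hqP
    simp [hnil hq, hqF, hqP]
  · exact fun q hq _ _ => hcons hq

end PreBFA

namespace AGrammar

open AExp PreBFA

variable {σ M : Type*} [DecidableEq σ] [DecidableEq M] [Fintype M]

theorem wellFormed_toBFA (l : List σ) (G : AGrammar σ M) : (G.toBFA l).WellFormed :=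
  have h := built_conv (built_convNT G.rule (Fintype.card M)) (.seq G.start (.star (anyOf l)))
    ⟨0, []⟩
  wellFormed_replaceTmp h.sane h.inRange

/-- The automaton of a grammar with linear expressions decides whether the start expression
succeeds, if its evaluation is deterministic. -/
theorem mem_language_toBFA {l : List σ} (hl : ∀ a, a ∈ l) {G : AGrammar σ M}
    (hstart : G.start.IsLinear) (hrule : ∀ A, (G.rule A).IsLinear) {x : List σ}
    {r : Option (List σ)} (hr : Eval G.rule ∅ G.start x r) :
    x ∈ (G.toBFA l).language ↔ r.isSome = true := by
  set K := Fintype.card M with hK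
  set call := convNT G.rule K with hcall
  have hbuilt : ∀ A S, Built S (call A S) := built_convNT G.rule K
  set R₁ := conv call G.start ⟨0, []⟩ with hR₁
  set R₂ := conv call (.star (anyOf l)) R₁.2 with hR₂
  have hany : (AExp.star (anyOf l) : AExp σ M).NFree := nFree_anyOf (σ := σ) (M := M) l
  have h₁ : Built ⟨0, []⟩ R₁ := built_conv hbuilt _ _
  have h₂ : Built R₁.2 R₂ := built_conv hbuilt _ _
  have h : Built ⟨0, []⟩ (conv call (.seq G.start (.star (anyOf l))) ⟨0, []⟩) :=
    built_conv hbuilt _ _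
  have hd := h₁.inRange.disjoint h₂.inRange le_rfl
  set B := PreBFA.seq R₁.1 R₂.1 with hB
  have hBfa : G.toBFA l = B.replaceTmp := rfl
  have hV : Models (B.finalValue K) B List.isEmpty := models_finalValue h.sane h.inRange
  -- Repeated consumption of any character succeeds and consumes everything.
  have htail (k : ℕ) (x : List σ) : R₂.1.f₀.eval (B.finalValue k x) = true := by
    have hV₂ := hV.seq_right h₁.sane hd
    rw [hany.correct_conv hbuilt R₁.2 _ _ hV₂ _ x _ (Eval.star_anyOf (rule := G.rule) hl x)
      (B.finalValue k x) x.isEmpty]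
    · cases x <;> simp [outcome]
    · have hst : ∀ q ∈ R₂.1.Q, B.finalValue k x q = B.finalValue K x q := by
        intro q hq
        obtain ⟨n, rfl, -⟩ := h₂.inRange q hq
        rw [finalValue_state, finalValue_state]
      exact ⟨fun q hq => (hst q (h₂.sane.F_subset hq)).trans (hV₂.F x q hq), fun q hq _ => hst q hq⟩
  -- Hence the final states of the start expression can be regarded as true on every input.
  set V : ℕ → List σ → BVar M → Bool :=
    fun k x => BForm.continued R₁.1.F R₂.1.f₀ (B.finalValue k x) with hVdef
  have hm : TailModels K V R₁.1 := by
    constructor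
    · have := hV.seq_left h₁.sane h₂.sane hd
      simp only [htail] at this
      exact this
    · intro i hi k x
      have hF : BVar.tmp i.1 ∉ R₁.1.F := fun hF => by
        obtain ⟨n, hn, -⟩ := h₁.inRange _ (h₁.sane.F_subset hF)
        exact absurd hn (by simp)
      have hmem : (i.1, i.2.phi R₂.1.f₀ R₁.1.F) ∈ B.inits :=
        List.mem_append_left _ (List.mem_map_of_mem (f := fun i : M × BForm (BVar M) =>
          (i.1, i.2.phi R₂.1.f₀ R₁.1.F)) hi)
      rw [hVdef]
      simp only
      rw [BForm.continued_of_notMem hF, ← BForm.eval_phi]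
      exact finalValue_tmp h.expanded.nodup hmem k x
  have hstate (k : ℕ) (x : List σ) (n : ℕ) : V k x (.state n) = V K x (.state n) := by
    simp only [hVdef, BForm.continued, htail, finalValue_state]
  obtain ⟨hc, ha⟩ := hstart.sound_conv (rule := G.rule) (D := fun A => A ∈ R₁.2.applied) hstate
    hbuilt (j := K) (fun A S hj hD hm => sound_convNT hstate hrule K A S hj hD hm) ⟨0, []⟩
    (by simp [hK]) (fun A hA => hA) hm
  have hval := hc.eq_isSome le_rfl (fun A hA => ha A hA List.not_mem_nil) hr (k := K) (by simp [hK])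
  rw [hBfa, mem_language_replaceTmp, ← hval, ← BForm.eval_phi]
  rfl

end AGrammar

theorem mainTheorem3 {σ N : Type*} [Fintype σ] [DecidableEq σ] [Fintype N] [DecidableEq N]
    (l : List σ) (hmem : ∀ a, a ∈ l)
    (G : PEG σ N) (hG : G.IsLPEG) (htotal : G.IsTotal) :
    ((G.unorder l).modify.toBFA l).WellFormed ∧
    (G.unorder l).modify.language = ((G.unorder l).modify.toBFA l).language ∧
    G.language = ((G.unorder l).modify.toBFA l).language := by
  have hstart : (G.unorder l).modify.start.IsLinear := (hG.1.unorder l).modify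
  have hrule : ∀ A, ((G.unorder l).modify.rule A).IsLinear := by
    rintro (A | A)
    exacts [((hG.2 A).unorder l).modify, ((hG.2 A).unorder l).copy]
  have heval {x : List σ} {r : Option (List σ)} (hr : PExp.Consume G.rule G.start x r) :
      AExp.Eval (G.unorder l).modify.rule ∅ (G.unorder l).modify.start x r :=
    (hr.eval hmem G).1
  refine ⟨AGrammar.wellFormed_toBFA l _, ?_, ?_⟩
  · ext x
    obtain ⟨r, hr⟩ := htotal x
    rw [AGrammar.mem_language_toBFA hmem hstart hrule (heval hr), Option.isSome_iff_exists]
    refine exists_congr fun y => ⟨fun h => (heval hr).unique h, ?_⟩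
    rintro rfl
    exact (heval hr).consume
  · ext x
    obtain ⟨r, hr⟩ := htotal x
    rw [AGrammar.mem_language_toBFA hmem hstart hrule (heval hr), Option.isSome_iff_exists]
    refine exists_congr fun y => ⟨fun h => (heval hr).unique (heval h).consume, ?_⟩
    rintro rfl
    exact hr
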